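/- Let $d,r\ge 1$ be integers. Let $B\in\mathbb{R}^{d\times d}$ be a Frolov matrix, that is: (a) $B$ is invertible; (b) $\bigl|\prod_{j=1}^d (Bm)_j\bigr|\ge 1$ for every $m\in\mathbb{Z}^d\setminus\{0\}$; (c) for all $x,y\in\mathbb{R}^d$ the axis-parallel box with opposite corners $x$ and $y$ contains at most $1+\prod_{j=1}^d|x_j-y_j|$ points of the lattice $B\mathbb{Z}^d$. For an invertible matrix $S\in\mathbb{R}^{d\times d}$ and $v\in\mathbb{R}^d$ let $$Q_S^v(f)=\frac{1}{|\det S|}\sum_{m\in\mathbb{Z}^d} f\bigl(S^{-\top}(m+v)\bigr),\qquad I_d(f)=\int_{\mathbb{R}^d} f(x)\,dx ,$$ and for $u\in\mathbb{R}^d$ let $\hat u=\mathrm{diag}(u_1,\dots,u_d)$. Let $H^{r,\mathrm{mix}}(\mathbb{R}^d)$ be the space of all real-valued $f\in L^2(\mathbb{R}^d)$ whose weak derivatives $D^\alpha f$ exist and lie in $L^2(\mathbb{R}^d)$ for every $\alpha\in\{0,\dots,r\}^d$; let $\mathring H^{r,\mathrm{mix}}([0,1]^d)$ be the space of the continuous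 functions in $H^{r,\mathrm{mix}}(\mathbb{R}^d)$ with support in $[0,1]^d$, and let $$\|f\|_{H^{r,\mathrm{mix}}([0,1]^d)}=\Bigl(\sum_{\alpha\in\{0,\dots,r\}^d}\|D^\alpha f\|_{L^2([0,1]^d)}^2\Bigr)^{1/2}.$$ **Theorem.** There is a constant $c>0$ (depending only on $d$, $r$ and $B$) such that for every shift parameter $v\in\mathbb{R}^d$, every integer $n\ge 2$ and every $f\in\mathring H^{r,\mathrm{mix}}([0,1]^d)$ $$\sup_{u\in[1,2^{1/d}]^d}\bigl|Q^v_{n^{1/d}\hat uB}(f)-I_d(f)\bigr|\le c\,n^{-r}(\log n)^{\frac{d-1}{2}}\,\|f\|_{H^{r,\mathrm{mix}}([0,1]^d)} .$$ In particular (the case $u=(1,\dots,1)$, $v=0$), Frolov's algorithm satisfies, with the same constant, $$\bigl|Q^0_{n^{1/d}B}(f)-I_d(f)\bigr|\le c\,n^{-r}(\log n)^{\frac{d-1}{2}}\,\|f\|_{H^{r,\mathrm{mix}}([0,1]^d)} .$$ -/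

import Mathlib

noncomputable section

namespace Frolov

open MeasureTheory

/-- The classical partial derivative of `φ` in the direction of the `i`-th coordinate. -/
def partialDeriv {d : ℕ} (i : Fin d) (φ : (Fin d → ℝ) → ℝ) : (Fin d → ℝ) → ℝ :=
  fun x => fderiv ℝ φ x (Pi.single i 1)

/-- The classical derivative `D^α φ = ∂₁^{α₁} ⋯ ∂_d^{α_d} φ`. -/
def multiDeriv {d : ℕ} (α : Fin d → ℕ) (φ : (Fin d → ℝ) → ℝ) : (Fin d → ℝ) → ℝ :=
  (List.finRange d).foldr (fun i g => (partialDeriv i)^[α i] g) φ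

/-- `g` is a weak derivative of order `α` of `f` on the open set `Ω`. -/
def IsWeakDeriv {d : ℕ} (Ω : Set (Fin d → ℝ)) (α : Fin d → ℕ) (f g : (Fin d → ℝ) → ℝ) : Prop :=
  LocallyIntegrableOn f Ω ∧ LocallyIntegrableOn g Ω ∧
    ∀ φ : (Fin d → ℝ) → ℝ, ContDiff ℝ (⊤ : ℕ∞) φ → HasCompactSupport φ → tsupport φ ⊆ Ω →
      ∫ x in Ω, f x * multiDeriv α φ x = (-1 : ℝ) ^ (∑ i, α i) * ∫ x in Ω, g x * φ x

open Classical in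
/-- The weak derivative `D^α f` on the open set `Ω` (determined up to equality almost everywhere;
it is `0` by convention where there is none). -/
def weakDeriv {d : ℕ} (Ω : Set (Fin d → ℝ)) (α : Fin d → ℕ) (f : (Fin d → ℝ) → ℝ) :
    (Fin d → ℝ) → ℝ :=
  if h : ∃ g, IsWeakDeriv Ω α f g then h.choose else 0

/-- `f` belongs to the Sobolev space `H^{r,mix}(Ω)` of dominating mixed smoothness `r`:
`f ∈ L²(Ω)` and `D^α f ∈ L²(Ω)` for every `α ∈ {0,…,r}^d`. -/
def MemHmix {d : ℕ} (r : ℕ) (Ω : Set (Fin d → ℝ)) (f : (Fin d → ℝ) → ℝ) : Prop :=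
  MemLp f 2 (volume.restrict Ω) ∧
    ∀ α : Fin d → ℕ, (∀ i, α i ≤ r) →
      ∃ g, IsWeakDeriv Ω α f g ∧ MemLp g 2 (volume.restrict Ω)

/-- The norm of `H^{r,mix}(Ω)`: the square root of the sum of `‖D^α f‖²_{L²(Ω)}` over all
`α ∈ {0,…,r}^d`. -/
def hmixNorm {d : ℕ} (r : ℕ) (Ω : Set (Fin d → ℝ)) (f : (Fin d → ℝ) → ℝ) : ℝ :=
  Real.sqrt (∑ α : Fin d → Fin (r + 1), ∫ x in Ω, (weakDeriv Ω (fun i => (α i : ℕ)) f x) ^ 2)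

/-- The open unit cube `(0,1)^d`. -/
def openCube (d : ℕ) : Set (Fin d → ℝ) := Set.univ.pi fun _ => Set.Ioo 0 1

/-- The norm of `H^{r,mix}([0,1]^d)`; derivatives are weak derivatives in the interior of the cube,
and the boundary of the cube is a null set. -/
def hmixNormCube (d r : ℕ) (f : (Fin d → ℝ) → ℝ) : ℝ := hmixNorm r (openCube d) f

/-- The space of all (continuous representatives of) functions in `H^{r,mix}(ℝ^d)` with support in
the unit cube `[0,1]^d`. -/
def HmixZero (d r : ℕ) : Set ((Fin d → ℝ) → ℝ) :=
  {f | Continuous f ∧ tsupport f ⊆ Set.Icc 0 1 ∧ MemHmix r Set.univ f}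

/-- The integral `I_d(f)` of `f` over `ℝ^d`. -/
def integralD {d : ℕ} (f : (Fin d → ℝ) → ℝ) : ℝ := ∫ x, f x

/-- The quadrature rule `Q_S^v(f) = |det S|⁻¹ ∑_{m ∈ ℤ^d} f(S^{-⊤}(m + v))`. -/
def quadRule {d : ℕ} (S : Matrix (Fin d) (Fin d) ℝ) (v : Fin d → ℝ) (f : (Fin d → ℝ) → ℝ) : ℝ :=
  1 / |S.det| * ∑' m : Fin d → ℤ, f (Matrix.mulVec (S⁻¹).transpose (fun i => (m i : ℝ) + v i))

/-- The lattice point `B m` for `m ∈ ℤ^d`. -/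
def latticePoint {d : ℕ} (B : Matrix (Fin d) (Fin d) ℝ) (m : Fin d → ℤ) : Fin d → ℝ :=
  Matrix.mulVec B (fun i => (m i : ℝ))

/-- Frolov matrices: (a) `B` is invertible; (b) `|∏ⱼ (Bm)ⱼ| ≥ 1` for all nonzero `m ∈ ℤ^d`;
(c) every axis-parallel box with opposite corners `x`, `y` and volume `V = ∏ⱼ |xⱼ - yⱼ|` contains
at most `V + 1` points of the lattice `B ℤ^d`. -/
structure IsFrolovMatrix {d : ℕ} (B : Matrix (Fin d) (Fin d) ℝ) : Prop where
  isUnit : IsUnit B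
  one_le_abs_prod : ∀ m : Fin d → ℤ, m ≠ 0 → 1 ≤ |∏ j, latticePoint B m j|
  card_box_le : ∀ x y : Fin d → ℝ,
    {z | z ∈ Set.range (latticePoint B) ∧ ∀ j, z j ∈ Set.uIcc (x j) (y j)}.Finite ∧
    (({z | z ∈ Set.range (latticePoint B) ∧ ∀ j, z j ∈ Set.uIcc (x j) (y j)}.ncard : ℕ) : ℝ)
      ≤ (∏ j, |x j - y j|) + 1

/-- The matrix `n^{1/d} û B`, where `û = diag(u₁,…,u_d)`. -/
def dilatedMatrix {d : ℕ} (n : ℕ) (u : Fin d → ℝ) (B : Matrix (Fin d) (Fin d) ℝ) :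
    Matrix (Fin d) (Fin d) ℝ :=
  (n : ℝ) ^ ((1 : ℝ) / d) • (Matrix.diagonal u * B)

/-- The box `[1, 2^{1/d}]^d` of dilation parameters. -/
def dilationBox (d : ℕ) : Set (Fin d → ℝ) := Set.Icc 1 (fun _ => (2 : ℝ) ^ ((1 : ℝ) / d))

end Frolov

end

namespace Frolov

open MeasureTheory Set

/-! Poisson summation on the dual lattice turns the error into an aliasing sum: for S = n^{1/d} û B,
Q_S^v(f) - I_d(f) is the sum over m ≠ 0 of the Fourier transform of f at Sm times a unimodular phase
(`abs_quadRule_sub_integralD_le`). The shift v enters only through the phases, so the bounds do not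
see it. Cauchy–Schwarz with the weight `mixWeight` splits the sum into two factors
(`summable_and_tsum_le_of_weighted`).

Smoothness factor: the weight times |f^|² is the sum of |(D^α f)^|² over the admissible α. Bessel's
inequality for a compactly supported function on the lattice bounds each sum by (2R+3)^d/|det S|
times ‖D^α f‖², where R bounds S^⊤ on the cube (`sum_mixWeight_mul_sq_le`). Since R is of order
n^{1/d} and det S of order n, the constant is uniform in n and u (`covering_const_le`).

Lattice factor: by (b), every nonzero point has |∏ (Sm)_j| ≥ n, so its dyadic level k satisfies 2^k
≥ n. Level k consists of at most (k+1)^{d-1} dyadic shapes, each inside a box that by (c) holds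
O(2^k/n) points, and the weight there is at least 2^{2rk}. Summing over k gives O(n^{-2r} (log
n)^{d-1}) (`sum_inv_mixWeight_le`). The square root of the product is the claim. -/

/-! ### Fourier series on the torus, transported to the unit cell. -/

/-- The character `x ↦ exp (2 π i ⟨ξ, x⟩)` of `ℝ^d`. -/
noncomputable def character {d : ℕ} (ξ x : Fin d → ℝ) : ℂ :=
  Complex.exp (2 * Real.pi * Complex.I * ((∑ i, ξ i * x i : ℝ) : ℂ))

/-- The half-open unit cube `(0,1]^d`. -/
def unitCell (d : ℕ) : Set (Fin d → ℝ) := {x | ∀ i, x i ∈ Ioc (0 : ℝ) 1}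

/-- The vector in `ℝ^d` with the given integer coordinates. -/
def intVec {d : ℕ} (m : Fin d → ℤ) : Fin d → ℝ := fun i => (m i : ℝ)

/-- The projection of `ℝ^d` onto the torus. -/
def toTorus {d : ℕ} (x : Fin d → ℝ) : UnitAddTorus (Fin d) := fun i => (x i : UnitAddCircle)

/-- The representative of a point of the torus in the half-open unit cube. -/
noncomputable def torusRep {d : ℕ} (t : UnitAddTorus (Fin d)) : Fin d → ℝ :=
  (UnitAddTorus.measurableEquivPiIoc (fun _ : Fin d => (0 : ℝ)) t).1

theorem continuous_character {d : ℕ} (ξ : Fin d → ℝ) : Continuous (character ξ) := by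
  unfold character; fun_prop

theorem norm_character {d : ℕ} (ξ x : Fin d → ℝ) : ‖character ξ x‖ = 1 := by
  rw [character, show (2 * Real.pi * Complex.I * ((∑ i, ξ i * x i : ℝ) : ℂ))
    = ((2 * Real.pi * ∑ i, ξ i * x i : ℝ) : ℂ) * Complex.I by push_cast; ring]
  exact Complex.norm_exp_ofReal_mul_I _

theorem mFourier_toTorus {d : ℕ} (m : Fin d → ℤ) (x : Fin d → ℝ) :
    UnitAddTorus.mFourier m (toTorus x) = character (intVec m) x := by
  simp only [UnitAddTorus.mFourier, ContinuousMap.coe_mk, toTorus, fourier_coe_apply, character,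
    intVec]
  rw [← Complex.exp_sum]
  congr 1
  push_cast
  rw [Finset.mul_sum]
  exact Finset.sum_congr rfl fun i _ => by ring

theorem toTorus_torusRep {d : ℕ} (t : UnitAddTorus (Fin d)) : toTorus (torusRep t) = t := by
  have := (UnitAddTorus.measurableEquivPiIoc (fun _ : Fin d => (0 : ℝ))).symm_apply_apply t
  rwa [UnitAddTorus.coe_symm_measurableEquivPiIoc] at this

theorem torusRep_toTorus {d : ℕ} {x : Fin d → ℝ} (hx : x ∈ unitCell d) :
    torusRep (toTorus x) = x := by
  have := (UnitAddTorus.measurableEquivPiIoc (fun _ : Fin d => (0 : ℝ))).apply_symm_apply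
    ⟨x, fun i => by simpa using hx i⟩
  rw [UnitAddTorus.coe_symm_measurableEquivPiIoc] at this
  exact congrArg Subtype.val this

theorem toTorus_eq_iff {d : ℕ} {x y : Fin d → ℝ} :
    toTorus x = toTorus y ↔ ∃ m : Fin d → ℤ, y = x + intVec m := by
  constructor
  · intro h
    have h' : ∀ i, ∃ m : ℤ, y i = x i + m := by
      intro i
      have := (QuotientAddGroup.eq (s := AddSubgroup.zmultiples (1 : ℝ))).1 (congrFun h i)
      obtain ⟨m, hm⟩ := AddSubgroup.mem_zmultiples_iff.1 this
      exact ⟨m, by simp at hm; linarith⟩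
    choose m hm using h'
    exact ⟨m, funext hm⟩
  · rintro ⟨m, rfl⟩
    funext i
    refine (QuotientAddGroup.eq (s := AddSubgroup.zmultiples (1 : ℝ))).2 ?_
    exact AddSubgroup.mem_zmultiples_iff.2 ⟨m i, by simp [intVec]⟩

theorem isOpenQuotientMap_toTorus (d : ℕ) : IsOpenQuotientMap (toTorus (d := d)) :=
  IsOpenQuotientMap.piMap fun _ => QuotientAddGroup.isOpenQuotientMap_mk

theorem measurableSet_unitCell (d : ℕ) : MeasurableSet (unitCell d) :=
  MeasurableSet.univ_pi' fun _ => measurableSet_Ioc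

theorem unitCell_eq (d : ℕ) :
    {x : Fin d → ℝ | ∀ i, x i ∈ Ioc ((fun _ => 0 : Fin d → ℝ) i) ((fun _ => 0 : Fin d → ℝ) i + 1)}
      = unitCell d := by simp [unitCell]

/-- The Fourier coefficients of a function with respect to the half-open unit cube. -/
noncomputable def cellCoeff {d : ℕ} (F : (Fin d → ℝ) → ℂ) (m : Fin d → ℤ) : ℂ :=
  ∫ x in unitCell d, character (intVec (-m)) x * F x

theorem mFourierCoeff_eq_cellCoeff {d : ℕ} (F : (Fin d → ℝ) → ℂ) (m : Fin d → ℤ) :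
    UnitAddTorus.mFourierCoeff (fun t => F (torusRep t)) m = cellCoeff F m := by
  rw [UnitAddTorus.mFourierCoeff_eq_integral _ _ (fun _ => 0), unitCell_eq, cellCoeff]
  refine setIntegral_congr_fun (measurableSet_unitCell d) fun x hx => ?_
  have h1 := mFourier_toTorus (-m) x
  have h2 := torusRep_toTorus hx
  have h3 : (fun i => (x i : UnitAddCircle)) = toTorus x := rfl
  simp only [h3, h1, h2, smul_eq_mul]

/-- A continuous periodic function with summable Fourier coefficients is the sum of its Fourier
series. -/
theorem hasSum_cellCoeff_character {d : ℕ} {F : (Fin d → ℝ) → ℂ} (hF : Continuous F)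
    (hper : ∀ x (m : Fin d → ℤ), F (x + intVec m) = F x) (hs : Summable (cellCoeff F))
    (x : Fin d → ℝ) : HasSum (fun m => cellCoeff F m * character (intVec m) x) (F x) := by
  have hcomp : ∀ y, F (torusRep (toTorus y)) = F y := by
    intro y
    obtain ⟨m, hm⟩ := toTorus_eq_iff.1 (toTorus_torusRep (toTorus y))
    rw [hm, hper, ← hm]
  -- `torusRep` jumps at the cell boundary; by periodicity the composite is the descent of `F` along
  -- the quotient map, hence continuous.
  have hcont : Continuous fun t => F (torusRep t) := by
    rw [(isOpenQuotientMap_toTorus d).isQuotientMap.continuous_iff]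
    exact hF.congr fun y => (hcomp y).symm
  let G : C(UnitAddTorus (Fin d), ℂ) := ⟨_, hcont⟩
  have hcoef : ∀ m, UnitAddTorus.mFourierCoeff G m = cellCoeff F m :=
    fun m => mFourierCoeff_eq_cellCoeff F m
  have := UnitAddTorus.hasSum_mFourier_series_apply_of_summable (f := G)
    (hs.congr fun m => (hcoef m).symm) (toTorus x)
  simp only [hcoef, mFourier_toTorus, smul_eq_mul] at this
  rw [← hcomp x]
  exact this

/-- Parseval's identity on the half-open unit cube. -/
theorem hasSum_sq_cellCoeff {d : ℕ} {F : (Fin d → ℝ) → ℂ}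
    (hF : MemLp F 2 (volume.restrict (unitCell d))) :
    HasSum (fun m => ‖cellCoeff F m‖ ^ 2) (∫ x in unitCell d, ‖F x‖ ^ 2) := by
  let _ : MeasureSpace UnitAddCircle := ⟨AddCircle.haarAddCircle⟩
  have hmp := UnitAddTorus.measurePreserving_equivPiIoc (fun _ : Fin d => (0 : ℝ))
  have hmp2 := measurePreserving_subtype_coe (μa := (volume : Measure (Fin d → ℝ)))
    (measurableSet_unitCell d)
  rw [← unitCell_eq] at hmp2
  rw [← unitCell_eq] at hF
  have hmp3 := hmp2.comp hmp
  have hL := hF.comp_measurePreserving hmp3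
  have key := UnitAddTorus.hasSum_sq_mFourierCoeff hL.toLp
  have hc : ∀ m, UnitAddTorus.mFourierCoeff hL.toLp m = cellCoeff F m := by
    intro m
    rw [← mFourierCoeff_eq_cellCoeff]
    refine integral_congr_ae ?_
    filter_upwards [hL.coeFn_toLp] with t ht
    rw [ht]; rfl
  simp only [hc] at key
  convert key using 1
  have : ∫ t, ‖(hL.toLp _) t‖ ^ 2 = ∫ t, ‖F (torusRep t)‖ ^ 2 := by
    refine integral_congr_ae ?_
    filter_upwards [hL.coeFn_toLp] with t ht
    rw [ht]; rfl
  rw [this]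
  have h2 := UnitAddTorus.integral_preimage (fun t => ‖F (torusRep t)‖ ^ 2) (fun _ : Fin d => (0 : ℝ))
  rw [unitCell_eq] at h2
  rw [h2]
  refine setIntegral_congr_fun (measurableSet_unitCell d) fun x hx => ?_
  have h3 := torusRep_toTorus hx
  have h4 : (fun i => (x i : UnitAddCircle)) = toTorus x := rfl
  simp only [h4, h3]

/-! ### Periodization: unfolding, Bessel's inequality, Poisson summation. -/

theorem character_add {d : ℕ} (ξ x y : Fin d → ℝ) :
    character ξ (x + y) = character ξ x * character ξ y := by
  rw [character, character, character, ← Complex.exp_add]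
  congr 1
  rw [← mul_add, ← Complex.ofReal_add, ← Finset.sum_add_distrib]
  simp [mul_add]

theorem character_intVec {d : ℕ} (m k : Fin d → ℤ) : character (intVec m) (intVec k) = 1 := by
  rw [character, Complex.exp_eq_one_iff]
  refine ⟨∑ i, m i * k i, ?_⟩
  simp only [intVec]
  push_cast
  ring

theorem integral_shift_unitCell {d : ℕ} (G : (Fin d → ℝ) → ℂ) (k : Fin d → ℤ) :
    ∫ x in (fun x => x + intVec k) '' unitCell d, G x = ∫ x in unitCell d, G (x + intVec k) :=
  ((measurePreserving_add_right volume (intVec k)).setIntegral_image_emb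
    (MeasurableEquiv.addRight (intVec k)).measurableEmbedding G (unitCell d))

theorem exists_mem_unitCell {d : ℕ} (x : Fin d → ℝ) :
    ∃ y ∈ unitCell d, ∃ k : Fin d → ℤ, x = y + intVec k := by
  -- The cell is closed on the right, hence `⌈x i⌉ - 1` instead of the floor.
  refine ⟨fun i => x i - (⌈x i⌉ - 1), fun i => ?_, fun i => ⌈x i⌉ - 1, ?_⟩
  · have h1 := Int.ceil_lt_add_one (x i)
    have h2 := Int.le_ceil (x i)
    constructor <;> linarith
  · funext i
    simp [intVec]

theorem unitCell_shift_unique {d : ℕ} {x y : Fin d → ℝ} (hx : x ∈ unitCell d) (hy : y ∈ unitCell d)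
    {k l : Fin d → ℤ} (h : x + intVec k = y + intVec l) : k = l := by
  funext i
  have h1 := congrFun h i
  simp only [Pi.add_apply, intVec] at h1
  have hx := hx i
  have hy := hy i
  simp only [mem_Ioc] at hx hy
  have h2 : (k i : ℝ) < l i + 1 := by linarith
  have h3 : (l i : ℝ) < k i + 1 := by linarith
  norm_cast at h2 h3
  omega

/-- Unfolding an integral over `ℝ^d` to the unit cube. -/
theorem integral_eq_integral_unitCell_sum {d : ℕ} {G : (Fin d → ℝ) → ℂ} (hG : Integrable G)
    {K : Finset (Fin d → ℤ)} (hK : ∀ x ∈ unitCell d, ∀ k ∉ K, G (x + intVec k) = 0) :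
    ∫ x, G x = ∫ x in unitCell d, ∑ k ∈ K, G (x + intVec k) := by
  have hm : ∀ k : Fin d → ℤ, MeasurableSet ((fun x => x + intVec k) '' unitCell d) := fun k =>
    (MeasurableEquiv.addRight (intVec k)).measurableEmbedding.measurableSet_image.2
      (measurableSet_unitCell d)
  rw [integral_finsetSum]
  · simp_rw [← integral_shift_unitCell]
    rw [← integral_biUnion_finset K (fun k _ => hm k) ?_ fun k _ => hG.integrableOn]
    · refine (setIntegral_eq_integral_of_forall_compl_eq_zero fun x hx => ?_).symm
      obtain ⟨y, hy, k, rfl⟩ := exists_mem_unitCell x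
      refine hK y hy k fun hk => hx ?_
      simp only [mem_iUnion]
      exact ⟨k, hk, y, hy, rfl⟩
    · intro k _ l _ hkl
      rw [Function.onFun, Set.disjoint_left]
      rintro _ ⟨x, hx, rfl⟩ ⟨y, hy, hxy⟩
      exact hkl (unitCell_shift_unique hy hx hxy).symm
  · intro k _
    exact (hG.comp_add_right (intVec k)).integrableOn

/-- The Fourier transform, as a function of the frequency. -/
noncomputable def fourierInt {d : ℕ} (G : (Fin d → ℝ) → ℂ) (ξ : Fin d → ℝ) : ℂ :=
  ∫ x, character (-ξ) x * G x

theorem intVec_neg {d : ℕ} (m : Fin d → ℤ) : intVec (-m) = -intVec m := by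
  funext i; simp [intVec]

theorem integrable_character_mul {d : ℕ} {G : (Fin d → ℝ) → ℂ} {μ : Measure (Fin d → ℝ)}
    (hG : Integrable G μ) (ξ : Fin d → ℝ) : Integrable (fun x => character ξ x * G x) μ :=
  hG.bdd_mul (continuous_character ξ).aestronglyMeasurable
    (Filter.Eventually.of_forall fun x => (norm_character ξ x).le)

/-- Characters of integer frequency are invariant under integer shifts, so the Fourier integral over
the whole space unfolds to the cell. -/
theorem cellCoeff_sum_shift {d : ℕ} {G : (Fin d → ℝ) → ℂ} (hG : Integrable G)
    {K : Finset (Fin d → ℤ)} (hK : ∀ x ∈ unitCell d, ∀ k ∉ K, G (x + intVec k) = 0)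
    (m : Fin d → ℤ) :
    cellCoeff (fun x => ∑ k ∈ K, G (x + intVec k)) m = fourierInt G (intVec m) := by
  rw [fourierInt, ← intVec_neg, integral_eq_integral_unitCell_sum (K := K)
    (integrable_character_mul hG _)]
  · rw [cellCoeff]
    simp_rw [character_add, character_intVec, mul_one, Finset.mul_sum]
  · intro x hx k hk
    rw [hK x hx k hk, mul_zero]

/-- The integer points whose coordinates are bounded by `⌊R⌋ + 1`. -/
noncomputable def intBox (d : ℕ) (R : ℝ) : Finset (Fin d → ℤ) :=
  Finset.Icc (fun _ => -(⌊R⌋ + 1)) (fun _ => ⌊R⌋ + 1)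

theorem mem_intBox {d : ℕ} {R : ℝ} {k : Fin d → ℤ} (h : ‖intVec k‖ ≤ R + 1) :
    k ∈ intBox d R := by
  rw [intBox, Finset.mem_Icc, Pi.le_def, Pi.le_def]
  have : ∀ i, |k i| ≤ ⌊R⌋ + 1 := fun i => by
    have := (norm_le_pi_norm (intVec k) i).trans h
    rw [intVec, Real.norm_eq_abs, ← Int.cast_abs] at this
    rw [← Int.floor_add_one]
    exact Int.le_floor.2 this
  exact ⟨fun i => (abs_le.1 (this i)).1, fun i => (abs_le.1 (this i)).2⟩

theorem card_intBox_le (d : ℕ) {R : ℝ} (hR : 0 ≤ R) : ((intBox d R).card : ℝ) ≤ (2 * R + 3) ^ d := by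
  have h0 := Int.floor_nonneg.2 hR
  rw [intBox, Pi.card_Icc]
  simp only [Int.card_Icc, Finset.prod_const, Finset.card_univ, Fintype.card_fin, Nat.cast_pow]
  refine pow_le_pow_left₀ (by positivity) ?_ d
  have h1 : (((⌊R⌋ + 1 + 1 - -(⌊R⌋ + 1)).toNat : ℤ) : ℝ) = 2 * ⌊R⌋ + 3 := by
    rw [Int.toNat_of_nonneg (by omega)]; push_cast; ring
  rw [Int.cast_natCast] at h1
  rw [h1]
  linarith [Int.floor_le R]

theorem norm_le_one_of_mem_unitCell {d : ℕ} {x : Fin d → ℝ} (hx : x ∈ unitCell d) : ‖x‖ ≤ 1 :=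
  (pi_norm_le_iff_of_nonneg zero_le_one).2 fun i => by
    rw [Real.norm_eq_abs, abs_le]
    have := hx i
    simp only [mem_Ioc] at this
    constructor <;> linarith

theorem shift_eq_zero_of_not_mem_intBox {d : ℕ} {G : (Fin d → ℝ) → ℂ} {R : ℝ}
    (hR : ∀ x, G x ≠ 0 → ‖x‖ ≤ R) : ∀ x ∈ unitCell d, ∀ k ∉ intBox d R, G (x + intVec k) = 0 := by
  intro x hx k hk
  by_contra h
  refine hk (mem_intBox ?_)
  have h1 := hR _ h
  have h2 := norm_le_one_of_mem_unitCell hx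
  calc ‖intVec k‖ = ‖x + intVec k - x‖ := by rw [add_sub_cancel_left]
    _ ≤ ‖x + intVec k‖ + ‖x‖ := norm_sub_le _ _
    _ ≤ R + 1 := add_le_add h1 h2

/-- Bessel's inequality for a function with bounded support. -/
theorem sum_sq_fourierInt_le {d : ℕ} {G : (Fin d → ℝ) → ℂ} (hG : MemLp G 2) {R : ℝ} (hR0 : 0 ≤ R)
    (hR : ∀ x, G x ≠ 0 → ‖x‖ ≤ R) :
    Summable (fun m : Fin d → ℤ => ‖fourierInt G (intVec m)‖ ^ 2) ∧
      ∑' m : Fin d → ℤ, ‖fourierInt G (intVec m)‖ ^ 2 ≤ (2 * R + 3) ^ d * ∫ x, ‖G x‖ ^ 2 := by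
  set K := intBox d R
  have hK := shift_eq_zero_of_not_mem_intBox hR
  have hsq : Integrable (fun x => ‖G x‖ ^ 2) := hG.integrable_norm_pow two_ne_zero
  have hint : Integrable G := by
    have hs : Function.support G ⊆ Metric.closedBall 0 R := fun x hx => by
      simpa using hR x hx
    rw [← integrableOn_iff_integrable_of_support_subset hs]
    have : IsFiniteMeasure (volume.restrict (Metric.closedBall (0 : Fin d → ℝ) R)) :=
      ⟨by simpa using (isCompact_closedBall (0 : Fin d → ℝ) R).measure_lt_top⟩
    exact (hG.restrict (Metric.closedBall 0 R)).integrable one_le_two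
  set F : (Fin d → ℝ) → ℂ := fun x => ∑ k ∈ K, G (x + intVec k) with hF
  have hsh : ∀ k : Fin d → ℤ, MemLp (fun x => G (x + intVec k)) 2 := fun k =>
    hG.comp_measurePreserving (measurePreserving_add_right volume (intVec k))
  have hFL : MemLp F 2 (volume.restrict (unitCell d)) :=
    (memLp_finsetSum K fun k _ => hsh k).restrict _
  have hP := hasSum_sq_cellCoeff hFL
  have hc : ∀ m, cellCoeff F m = fourierInt G (intVec m) := cellCoeff_sum_shift hint hK
  simp only [hc] at hP
  refine ⟨hP.summable, ?_⟩
  rw [hP.tsum_eq]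
  -- Cast to `ℂ` because the unfolding lemma is stated for complex functions.
  have hunf : ((∫ x, ‖G x‖ ^ 2 : ℝ) : ℂ)
      = ((∫ x in unitCell d, ∑ k ∈ K, ‖G (x + intVec k)‖ ^ 2 : ℝ) : ℂ) := by
    have := integral_eq_integral_unitCell_sum (G := fun x => ((‖G x‖ ^ 2 : ℝ) : ℂ)) hsq.ofReal
      (K := K) fun x hx k hk => by simp [hK x hx k hk]
    rw [← integral_complex_ofReal, ← integral_complex_ofReal, this]
    simp only [Complex.ofReal_sum]
  rw [Complex.ofReal_inj] at hunf
  have hi : Integrable (fun x => ∑ k ∈ K, ‖G (x + intVec k)‖ ^ 2)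
      (volume.restrict (unitCell d)) :=
    (integrable_finsetSum K fun k _ => (hsh k).integrable_norm_pow two_ne_zero).restrict
  -- At most `K.card` translates meet the cell; Cauchy–Schwarz over them costs this factor.
  calc ∫ x in unitCell d, ‖∑ k ∈ K, G (x + intVec k)‖ ^ 2
      ≤ ∫ x in unitCell d, (K.card : ℝ) * ∑ k ∈ K, ‖G (x + intVec k)‖ ^ 2 := by
        refine integral_mono (hFL.integrable_norm_pow two_ne_zero) (hi.const_mul _) fun x => ?_
        exact (pow_le_pow_left₀ (norm_nonneg _) (norm_sum_le _ _) 2).trans sq_sum_le_card_mul_sum_sq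
    _ = K.card * ∫ x, ‖G x‖ ^ 2 := by rw [integral_const_mul, hunf]
    _ ≤ _ := mul_le_mul_of_nonneg_right (card_intBox_le d hR0) (by positivity)

/-- The Poisson summation formula for a continuous function with bounded support and summable
Fourier coefficients. -/
theorem hasSum_fourierInt_character {d : ℕ} {G : (Fin d → ℝ) → ℂ} (hG : Continuous G) {R : ℝ}
    (hR : ∀ x, G x ≠ 0 → ‖x‖ ≤ R)
    (hs : Summable fun m : Fin d → ℤ => fourierInt G (intVec m)) (v : Fin d → ℝ) :
    HasSum (fun m : Fin d → ℤ => fourierInt G (intVec m) * character (intVec m) v)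
      (∑' k : Fin d → ℤ, G (v + intVec k)) := by
  have hcs : HasCompactSupport G := by
    refine HasCompactSupport.intro (isCompact_closedBall (0 : Fin d → ℝ) R) fun x hx => ?_
    by_contra h
    exact hx (by simpa using hR x h)
  have hint : Integrable G := hG.integrable_of_hasCompactSupport hcs
  -- Bounded support leaves finitely many nonzero translates near each point, so the periodization
  -- is a locally finite sum and is continuous.
  have hlf : LocallyFinite fun k : Fin d → ℤ => Function.support fun x => G (x + intVec k) := by
    intro x
    refine ⟨Metric.ball x 1, Metric.ball_mem_nhds x one_pos, ?_⟩
    refine (intBox d (R + ‖x‖)).finite_toSet.subset ?_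
    rintro k ⟨y, hy, hyx⟩
    refine mem_intBox ?_
    have h1 := hR _ hy
    have h2 : ‖y‖ ≤ 1 + ‖x‖ := by
      rw [mem_ball_iff_norm] at hyx
      have := norm_add_le (y - x) x
      rw [sub_add_cancel] at this
      linarith
    have h3 := norm_sub_le (y + intVec k) y
    rw [add_sub_cancel_left] at h3
    linarith
  have hfin : ∀ x, (∑' k : Fin d → ℤ, G (x + intVec k)) = ∑ᶠ k : Fin d → ℤ, G (x + intVec k) :=
    fun x => tsum_eq_finsum (hlf.point_finite x)
  set F : (Fin d → ℝ) → ℂ := fun x => ∑' k : Fin d → ℤ, G (x + intVec k)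
  have hFc : Continuous F := by
    have : F = fun x => ∑ᶠ k : Fin d → ℤ, G (x + intVec k) := funext hfin
    rw [this]
    exact continuous_finsum (fun k => hG.comp (continuous_add_const _)) hlf
  have hper : ∀ x (m : Fin d → ℤ), F (x + intVec m) = F x := by
    intro x m
    change ∑' k : Fin d → ℤ, _ = ∑' k : Fin d → ℤ, _
    rw [← (Equiv.addLeft m).tsum_eq fun k => G (x + intVec k)]
    refine tsum_congr fun k => ?_
    congr 1
    funext i
    simp [intVec, add_assoc]
  have hK := shift_eq_zero_of_not_mem_intBox hR
  have hcoef : ∀ m, cellCoeff F m = fourierInt G (intVec m) := by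
    intro m
    rw [← cellCoeff_sum_shift hint hK]
    refine setIntegral_congr_fun (measurableSet_unitCell d) fun x hx => ?_
    change _ * (∑' k : Fin d → ℤ, G (x + intVec k)) = _
    rw [tsum_eq_sum (fun k hk => hK x hx k hk)]
  have := hasSum_cellCoeff_character hFc hper (hs.congr fun m => (hcoef m).symm) v
  simpa only [hcoef] using this

/-! ### Linear change of variables and the aliasing error. -/

section LinearChange

variable {d : ℕ} {S : Matrix (Fin d) (Fin d) ℝ}

theorem det_inv_transpose_ne_zero (hS : S.det ≠ 0) : (S⁻¹).transpose.det ≠ 0 := by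
  rw [Matrix.det_transpose, Matrix.det_nonsing_inv]
  simpa using hS

theorem measurableEmbedding_mulVec (hS : S.det ≠ 0) : MeasurableEmbedding fun x => S.mulVec x :=
  (Matrix.mulVecLin S).continuous_of_finiteDimensional.measurableEmbedding
    (Matrix.mulVec_injective_of_isUnit ((Matrix.isUnit_iff_isUnit_det S).2 (Ne.isUnit hS)))

theorem map_inv_transpose_volume (hS : S.det ≠ 0) :
    Measure.map (fun x => (S⁻¹).transpose.mulVec x) volume
      = ENNReal.ofReal |S.det| • (volume : Measure (Fin d → ℝ)) := by
  have := Real.map_matrix_volume_pi_eq_smul_volume_pi (det_inv_transpose_ne_zero hS)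
  rw [Matrix.det_transpose, Matrix.det_nonsing_inv, Ring.inverse_eq_inv', inv_inv] at this
  exact this

theorem integral_comp_inv_transpose {E : Type*} [NormedAddCommGroup E] [NormedSpace ℝ E]
    (hS : S.det ≠ 0) (H : (Fin d → ℝ) → E) :
    ∫ x, H ((S⁻¹).transpose.mulVec x) = |S.det| • ∫ x, H x := by
  rw [← (measurableEmbedding_mulVec (det_inv_transpose_ne_zero hS)).integral_map,
    map_inv_transpose_volume hS, integral_smul_measure, ENNReal.toReal_ofReal (abs_nonneg _)]

theorem memLp_comp_inv_transpose (hS : S.det ≠ 0) {H : (Fin d → ℝ) → ℂ} (hH : MemLp H 2) :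
    MemLp (fun x => H ((S⁻¹).transpose.mulVec x)) 2 := by
  have h := hH.smul_measure (c := ENNReal.ofReal |S.det|) ENNReal.ofReal_ne_top
  rw [← map_inv_transpose_volume hS] at h
  exact h.comp_of_map
    (measurableEmbedding_mulVec (det_inv_transpose_ne_zero hS)).measurable.aemeasurable

theorem transpose_mulVec_inv_transpose (hS : S.det ≠ 0) (x : Fin d → ℝ) :
    S.transpose.mulVec ((S⁻¹).transpose.mulVec x) = x := by
  rw [Matrix.mulVec_mulVec, ← Matrix.transpose_mul, Matrix.nonsing_inv_mul _ (Ne.isUnit hS),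
    Matrix.transpose_one, Matrix.one_mulVec]

theorem character_transpose_mulVec (ξ x : Fin d → ℝ) :
    character ξ (S.transpose.mulVec x) = character (S.mulVec ξ) x := by
  have h : ξ ⬝ᵥ S.transpose.mulVec x = S.mulVec ξ ⬝ᵥ x := by
    rw [Matrix.dotProduct_mulVec, Matrix.vecMul_transpose]
  simp only [dotProduct] at h
  rw [character, character, h]

/-- Since ⟨ξ, S^⊤ y⟩ = ⟨Sξ, y⟩, nodes in S^{-⊤}ℤ^d produce frequencies in Sℤ^d. -/
theorem fourierInt_comp_inv_transpose (hS : S.det ≠ 0) (H : (Fin d → ℝ) → ℂ) (ξ : Fin d → ℝ) :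
    fourierInt (fun x => H ((S⁻¹).transpose.mulVec x)) ξ
      = |S.det| • fourierInt H (S.mulVec ξ) := by
  rw [fourierInt, fourierInt, ← integral_comp_inv_transpose hS]
  refine integral_congr_ae (Filter.Eventually.of_forall fun x => ?_)
  simp only
  rw [← Matrix.mulVec_neg, ← character_transpose_mulVec, transpose_mulVec_inv_transpose hS]

/-- Bessel's inequality for the Fourier transform at the points of a lattice. -/
theorem sum_sq_fourierInt_lattice_le (hS : S.det ≠ 0) {H : (Fin d → ℝ) → ℂ} (hH : MemLp H 2)
    {R : ℝ} (hR0 : 0 ≤ R) (hR : ∀ x, H x ≠ 0 → ‖S.transpose.mulVec x‖ ≤ R) :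
    Summable (fun m : Fin d → ℤ => ‖fourierInt H (S.mulVec (intVec m))‖ ^ 2) ∧
      ∑' m : Fin d → ℤ, ‖fourierInt H (S.mulVec (intVec m))‖ ^ 2
        ≤ (2 * R + 3) ^ d / |S.det| * ∫ x, ‖H x‖ ^ 2 := by
  have hdet : 0 < |S.det| := abs_pos.2 hS
  obtain ⟨h1, h2⟩ := sum_sq_fourierInt_le (memLp_comp_inv_transpose hS hH) hR0
    (fun x hx => by simpa [transpose_mulVec_inv_transpose hS] using hR _ hx)
  have h3 := integral_comp_inv_transpose hS fun x => ‖H x‖ ^ 2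
  simp only [fourierInt_comp_inv_transpose hS, norm_smul, mul_pow, norm_abs_eq_norm,
    Real.norm_eq_abs] at h1 h2
  rw [h3] at h2
  -- The coefficients carry |det S|² and the integral |det S|, which leaves the factor 1/|det S|.
  rw [summable_mul_left_iff (pow_ne_zero 2 hdet.ne')] at h1
  refine ⟨h1, ?_⟩
  rw [tsum_mul_left, smul_eq_mul] at h2
  rw [div_mul_eq_mul_div, le_div_iff₀ hdet]
  refine le_of_mul_le_mul_left ?_ hdet
  linarith

/-- The error of the quadrature rule is bounded by the sum of the absolute values of the Fourier
transform at the nonzero points of the dual lattice. -/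
theorem abs_quadRule_sub_integralD_le (hS : S.det ≠ 0) {f : (Fin d → ℝ) → ℝ} (hf : Continuous f)
    {R : ℝ} (hR : ∀ x, f x ≠ 0 → ‖S.transpose.mulVec x‖ ≤ R)
    (hs : Summable fun m : Fin d → ℤ =>
      ‖fourierInt (fun x => (f x : ℂ)) (S.mulVec (intVec m))‖) (v : Fin d → ℝ) :
    |quadRule S v f - integralD f| ≤ ∑' m : Fin d → ℤ,
      if m = 0 then 0 else ‖fourierInt (fun x => (f x : ℂ)) (S.mulVec (intVec m))‖ := by
  have hdet : 0 < |S.det| := abs_pos.2 hS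
  set a : (Fin d → ℤ) → ℂ := fun m => fourierInt (fun x => (f x : ℂ)) (S.mulVec (intVec m))
  set G : (Fin d → ℝ) → ℂ := fun x => (f ((S⁻¹).transpose.mulVec x) : ℂ) with hGdef
  have hG : Continuous G := Complex.continuous_ofReal.comp
    (hf.comp (Matrix.mulVecLin (S⁻¹).transpose).continuous_of_finiteDimensional)
  have hcoef : ∀ m, fourierInt G (intVec m) = |S.det| • a m := fun m =>
    fourierInt_comp_inv_transpose hS (fun x => (f x : ℂ)) (intVec m)
  have hP := hasSum_fourierInt_character hG (R := R) (fun x hx => by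
    simpa [transpose_mulVec_inv_transpose hS] using hR _ (Complex.ofReal_ne_zero.1 hx))
    (by simpa only [hcoef] using (hs.of_norm).const_smul |S.det|) v
  simp only [hcoef, smul_mul_assoc] at hP
  have hP' := hP.const_smul |S.det|⁻¹
  simp only [smul_smul, inv_mul_cancel₀ hdet.ne', one_smul] at hP'
  have hQ : |S.det|⁻¹ • ∑' k : Fin d → ℤ, G (v + intVec k) = (quadRule S v f : ℂ) := by
    rw [quadRule, Complex.real_smul, Complex.ofReal_mul, Complex.ofReal_tsum, one_div]
    congr 1
    refine tsum_congr fun k => ?_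
    simp only [hGdef]
    congr 3
    funext i
    simp [intVec, add_comm]
  rw [hQ] at hP'
  have h0 : a 0 * character (intVec 0) v = (integralD f : ℂ) := by
    have h1 : intVec (0 : Fin d → ℤ) = 0 := by funext i; simp [intVec]
    simp only [a, h1, Matrix.mulVec_zero, fourierInt, neg_zero, integralD]
    simp only [character, Pi.zero_apply, zero_mul, Finset.sum_const_zero, Complex.ofReal_zero,
      mul_zero, Complex.exp_zero, one_mul, mul_one]
    exact integral_complex_ofReal
  -- The frequency zero contributes the integral; replacing its term by zero leaves the error.
  have hE := hP'.update 0 0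
  rw [h0, zero_sub, neg_add_eq_sub, ← Complex.ofReal_sub] at hE
  rw [← Real.norm_eq_abs, ← Complex.norm_real, ← hE.tsum_eq]
  have hn : ∀ m, ‖Function.update (fun m => a m * character (intVec m) v) 0 0 m‖
      = if m = 0 then 0 else ‖a m‖ := by
    intro m
    rw [Function.update_apply]
    split_ifs <;> simp [norm_character]
  refine (norm_tsum_le_tsum_norm ?_).trans_eq (tsum_congr hn)
  simp only [hn]
  refine Summable.of_nonneg_of_le (fun m => ?_) (fun m => ?_) hs <;> split_ifs <;> simp [a]

end LinearChange

/-! ### Classical derivatives: locality and plane waves. -/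

theorem partialDeriv_congr_of_isOpen {d : ℕ} {U : Set (Fin d → ℝ)} (hU : IsOpen U)
    {φ ψ : (Fin d → ℝ) → ℝ} (h : EqOn φ ψ U) (i : Fin d) :
    EqOn (partialDeriv i φ) (partialDeriv i ψ) U := by
  intro x hx
  rw [partialDeriv, partialDeriv, Filter.EventuallyEq.fderiv_eq]
  exact Filter.eventuallyEq_of_mem (hU.mem_nhds hx) h

theorem partialDeriv_iterate_congr_of_isOpen {d : ℕ} {U : Set (Fin d → ℝ)} (hU : IsOpen U)
    {φ ψ : (Fin d → ℝ) → ℝ} (h : EqOn φ ψ U) (i : Fin d) (n : ℕ) :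
    EqOn ((partialDeriv i)^[n] φ) ((partialDeriv i)^[n] ψ) U := by
  induction n with
  | zero => exact h
  | succ n ih =>
    rw [Function.iterate_succ_apply', Function.iterate_succ_apply']
    exact partialDeriv_congr_of_isOpen hU ih i

/-- Locality permits a plane wave to be replaced by a cut-off of it wherever the cut-off equals one.
-/
theorem multiDeriv_congr_of_isOpen {d : ℕ} {U : Set (Fin d → ℝ)} (hU : IsOpen U)
    {φ ψ : (Fin d → ℝ) → ℝ} (h : EqOn φ ψ U) (α : Fin d → ℕ) :
    EqOn (multiDeriv α φ) (multiDeriv α ψ) U := by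
  rw [multiDeriv, multiDeriv]
  induction List.finRange d with
  | nil => exact h
  | cons i l ih => exact partialDeriv_iterate_congr_of_isOpen hU ih i (α i)

/-- The plane wave `x ↦ cos (⟨a, x⟩ + θ)`. -/
noncomputable def planeWave {d : ℕ} (a : Fin d → ℝ) (θ : ℝ) (x : Fin d → ℝ) : ℝ :=
  Real.cos (∑ i, a i * x i + θ)

theorem contDiff_planeWave {d : ℕ} (a : Fin d → ℝ) (θ : ℝ) {n : WithTop ℕ∞} :
    ContDiff ℝ n (planeWave a θ) := by
  unfold planeWave; fun_prop

/-- Differentiating a cosine shifts its phase by π/2, so multiples of plane waves are closed under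
differentiation; the constant `c` makes the statement iterable. -/
theorem partialDeriv_const_mul_planeWave {d : ℕ} (i : Fin d) (c : ℝ) (a : Fin d → ℝ) (θ : ℝ) :
    partialDeriv i (fun x => c * planeWave a θ x)
      = fun x => (c * a i) * planeWave a (θ + Real.pi / 2) x := by
  funext x
  have h1 : HasFDerivAt (fun x : Fin d → ℝ => ∑ j, a j * x j + θ)
      (∑ j, a j • ContinuousLinearMap.proj (R := ℝ) (φ := fun _ : Fin d => ℝ) j) x :=
    (HasFDerivAt.fun_sum fun j _ => (hasFDerivAt_apply j x).const_mul (a j)).add_const θ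
  have h2 := (h1.cos).const_mul c
  rw [partialDeriv, planeWave, show (fun x => c * planeWave a θ x)
    = fun x => c * Real.cos (∑ j, a j * x j + θ) from rfl, h2.fderiv, ← add_assoc,
    Real.cos_add_pi_div_two]
  simp [Pi.single_apply]
  ring

theorem partialDeriv_iterate_planeWave {d : ℕ} (i : Fin d) (c : ℝ) (a : Fin d → ℝ) (θ : ℝ) (n : ℕ) :
    (partialDeriv i)^[n] (fun x => c * planeWave a θ x)
      = fun x => (c * a i ^ n) * planeWave a (θ + n * (Real.pi / 2)) x := by
  induction n with
  | zero => simp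
  | succ n ih =>
    rw [Function.iterate_succ_apply', ih, partialDeriv_const_mul_planeWave]
    funext x
    rw [pow_succ, ← mul_assoc, add_assoc]
    congr 2
    push_cast
    ring

theorem multiDeriv_planeWave {d : ℕ} (α : Fin d → ℕ) (a : Fin d → ℝ) (θ : ℝ) :
    multiDeriv α (planeWave a θ)
      = fun x => (∏ i, a i ^ α i) * planeWave a (θ + (∑ i, α i : ℕ) * (Real.pi / 2)) x := by
  have key : ∀ l : List (Fin d), l.foldr (fun i g => (partialDeriv i)^[α i] g) (planeWave a θ)
      = fun x => (l.map fun i => a i ^ α i).prod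
          * planeWave a (θ + ((l.map α).sum : ℕ) * (Real.pi / 2)) x := by
    intro l
    induction l with
    | nil => funext x; simp
    | cons i l ih =>
      rw [List.foldr_cons, ih, partialDeriv_iterate_planeWave]
      funext x
      rw [List.map_cons, List.prod_cons, List.map_cons, List.sum_cons, mul_comm (a i ^ α i)]
      congr 2
      push_cast
      ring
  rw [multiDeriv, key]
  rw [← List.ofFn_eq_map, ← List.ofFn_eq_map, List.prod_ofFn, List.sum_ofFn]

theorem multiDeriv_eq_zero_of_notMem_tsupport {d : ℕ} (α : Fin d → ℕ) {φ : (Fin d → ℝ) → ℝ}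
    {x : Fin d → ℝ} (hx : x ∉ tsupport φ) : multiDeriv α φ x = 0 := by
  -- Zero is written as a multiple of a plane wave so that the iteration formula applies to it.
  have h0 : EqOn φ (fun y => 0 * planeWave (0 : Fin d → ℝ) 0 y) (tsupport φ)ᶜ := fun y hy => by
    simp [image_eq_zero_of_notMem_tsupport hy]
  rw [multiDeriv_congr_of_isOpen (isClosed_tsupport φ).isOpen_compl h0 α hx, multiDeriv]
  have key : ∀ l : List (Fin d), l.foldr (fun i g => (partialDeriv i)^[α i] g)
      (fun y => 0 * planeWave (0 : Fin d → ℝ) 0 y) = fun _ => 0 := by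
    intro l
    have hz : (fun y => 0 * planeWave (0 : Fin d → ℝ) 0 y) = fun _ => (0 : ℝ) := by simp
    induction l with
    | nil => exact hz
    | cons i l ih =>
      rw [List.foldr_cons, ih, ← hz, partialDeriv_iterate_planeWave]
      simp
  rw [key]

/-! ### Weak derivatives: uniqueness, restriction, support. -/

/-- Weak derivatives are unique up to equality almost everywhere. -/
theorem IsWeakDeriv.ae_eq {d : ℕ} {Ω : Set (Fin d → ℝ)} (hΩ : IsOpen Ω) {α : Fin d → ℕ}
    {f g h : (Fin d → ℝ) → ℝ} (hg : IsWeakDeriv Ω α f g) (hh : IsWeakDeriv Ω α f h) :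
    g =ᵐ[volume.restrict Ω] h := by
  have key := hΩ.ae_eq_zero_of_integral_contDiff_smul_eq_zero (μ := volume)
    (f := fun x => g x - h x) (hg.2.1.sub hh.2.1) ?_
  · rw [Filter.EventuallyEq, ae_restrict_iff' hΩ.measurableSet]
    filter_upwards [key] with x hx hxΩ
    exact sub_eq_zero.1 (hx hxΩ)
  · intro φ hφ hcs hsupp
    have h1 := hg.2.2 φ hφ hcs hsupp
    rw [hh.2.2 φ hφ hcs hsupp] at h1
    have h2 := mul_left_cancel₀ (pow_ne_zero _ (by norm_num)) h1
    have hi : ∀ u : (Fin d → ℝ) → ℝ, LocallyIntegrableOn u Ω →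
        IntegrableOn (fun x => u x * φ x) Ω := by
      intro u hu
      have h3 := (hu.integrableOn_compact_subset hsupp hcs).mul_continuousOn
        hφ.continuous.continuousOn hcs
      have h4 : IntegrableOn (fun x => u x * φ x) univ := by
        rw [integrableOn_univ]
        refine (integrableOn_iff_integrable_of_support_subset fun x hx => ?_).1 h3
        exact subset_tsupport φ (right_ne_zero_of_mul hx)
      exact h4.mono_set (subset_univ _)
    have h5 : ∫ x in Ω, φ x • (g x - h x) = ∫ x, φ x • (g x - h x) := by
      refine setIntegral_eq_integral_of_forall_compl_eq_zero fun x hx => ?_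
      rw [image_eq_zero_of_notMem_tsupport fun hx' => hx (hsupp hx'), zero_smul]
    rw [← h5]
    calc ∫ x in Ω, φ x • (g x - h x) = ∫ x in Ω, (g x * φ x - h x * φ x) := by
          congr 1; funext x; simp; ring
      _ = 0 := by rw [integral_sub (hi g hg.2.1) (hi h hh.2.1), h2, sub_self]

/-- Weak derivatives restrict to smaller sets. -/
theorem IsWeakDeriv.mono {d : ℕ} {Ω : Set (Fin d → ℝ)} {α : Fin d → ℕ}
    {f g : (Fin d → ℝ) → ℝ} (h : IsWeakDeriv univ α f g) : IsWeakDeriv Ω α f g := by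
  refine ⟨h.1.mono_set (subset_univ _), h.2.1.mono_set (subset_univ _), fun φ hφ hcs hsupp => ?_⟩
  have := h.2.2 φ hφ hcs (subset_univ _)
  rw [setIntegral_univ, setIntegral_univ] at this
  rw [setIntegral_eq_integral_of_forall_compl_eq_zero,
    setIntegral_eq_integral_of_forall_compl_eq_zero, this]
  · intro x hx
    rw [image_eq_zero_of_notMem_tsupport fun hx' => hx (hsupp hx'), mul_zero]
  · intro x hx
    rw [multiDeriv_eq_zero_of_notMem_tsupport α fun hx' => hx (hsupp hx'), mul_zero]

/-- A weak derivative vanishes almost everywhere outside the support of the function. -/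
theorem IsWeakDeriv.ae_eq_zero_compl {d : ℕ} {α : Fin d → ℕ} {f g : (Fin d → ℝ) → ℝ}
    (h : IsWeakDeriv univ α f g) {C : Set (Fin d → ℝ)} (hC : IsClosed C) (hf : tsupport f ⊆ C) :
    ∀ᵐ x, x ∉ C → g x = 0 := by
  have hg := h.mono (Ω := Cᶜ)
  -- Off `C` the function vanishes, so zero is also a weak derivative there and uniqueness applies.
  have h0 : IsWeakDeriv Cᶜ α f 0 := by
    refine ⟨hg.1, (locallyIntegrable_zero.locallyIntegrableOn _), fun φ _ _ _ => ?_⟩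
    rw [setIntegral_eq_zero_of_forall_eq_zero]
    · simp
    · intro x hx
      rw [image_eq_zero_of_notMem_tsupport fun hx' => hx (hf hx'), zero_mul]
  have := hg.ae_eq hC.isOpen_compl h0
  rwa [Filter.EventuallyEq, ae_restrict_iff' hC.isOpen_compl.measurableSet] at this

/-! ### Fourier transform of a weak derivative, through real plane waves. -/

/-- The integral of `u` against a plane wave. -/
noncomputable def waveInt {d : ℕ} (a : Fin d → ℝ) (u : (Fin d → ℝ) → ℝ) (θ : ℝ) : ℝ :=
  ∫ x, u x * planeWave a θ x

theorem integrable_mul_planeWave {d : ℕ} {u : (Fin d → ℝ) → ℝ} (hu : Integrable u)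
    (a : Fin d → ℝ) (θ : ℝ) : Integrable fun x => u x * planeWave a θ x :=
  hu.mul_bdd (c := 1)
    (contDiff_planeWave a θ (n := 0)).continuous.aestronglyMeasurable
    (Filter.Eventually.of_forall fun _ => Real.abs_cos_le_one _)

theorem waveInt_eq {d : ℕ} {u : (Fin d → ℝ) → ℝ} (hu : Integrable u) (a : Fin d → ℝ) (θ : ℝ) :
    waveInt a u θ
      = Real.cos θ * waveInt a u 0 + Real.sin θ * waveInt a u (Real.pi / 2) := by
  simp only [waveInt]
  rw [← integral_const_mul, ← integral_const_mul, ← integral_add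
    ((integrable_mul_planeWave hu a _).const_mul _) ((integrable_mul_planeWave hu a _).const_mul _)]
  congr 1
  funext x
  simp only [planeWave, add_zero, Real.cos_add, Real.cos_pi_div_two, Real.sin_pi_div_two]
  ring

/-- Changing the phase rotates the pair of integrals at phases a quarter period apart, which
preserves the sum of squares. -/
theorem waveInt_sq_add_sq {d : ℕ} {u : (Fin d → ℝ) → ℝ} (hu : Integrable u) (a : Fin d → ℝ)
    (θ : ℝ) : waveInt a u θ ^ 2 + waveInt a u (Real.pi / 2 + θ) ^ 2
      = waveInt a u 0 ^ 2 + waveInt a u (Real.pi / 2) ^ 2 := by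
  rw [waveInt_eq hu a θ, waveInt_eq hu a (Real.pi / 2 + θ), add_comm _ θ, Real.cos_add_pi_div_two,
    Real.sin_add_pi_div_two]
  linear_combination (waveInt a u 0 ^ 2 + waveInt a u (Real.pi / 2) ^ 2) * Real.sin_sq_add_cos_sq θ

/-- From e^{-it} = cos t + i cos(t + π/2): the two phases are the real and imaginary parts. -/
theorem norm_sq_fourierInt_ofReal {d : ℕ} {u : (Fin d → ℝ) → ℝ} (hu : Integrable u)
    (ξ : Fin d → ℝ) : ‖fourierInt (fun x => (u x : ℂ)) ξ‖ ^ 2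
      = waveInt (fun i => 2 * Real.pi * ξ i) u 0 ^ 2
        + waveInt (fun i => 2 * Real.pi * ξ i) u (Real.pi / 2) ^ 2 := by
  set a : Fin d → ℝ := fun i => 2 * Real.pi * ξ i
  have h : fourierInt (fun x => (u x : ℂ)) ξ
      = (waveInt a u 0 : ℂ) + (waveInt a u (Real.pi / 2) : ℂ) * Complex.I := by
    rw [waveInt, waveInt, ← integral_complex_ofReal, ← integral_complex_ofReal,
      ← integral_mul_const, ← integral_add (integrable_mul_planeWave hu a _).ofReal
      ((integrable_mul_planeWave hu a _).ofReal.mul_const _), fourierInt]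
    congr 1
    funext x
    have h1 : character (-ξ) x = Complex.exp (((-(∑ i, a i * x i) : ℝ) : ℂ) * Complex.I) := by
      rw [character]
      congr 1
      simp only [a, Pi.neg_apply, neg_mul, Finset.sum_neg_distrib]
      push_cast
      simp only [mul_assoc, ← Finset.mul_sum]
      ring
    rw [h1, Complex.exp_mul_I, ← Complex.ofReal_cos, ← Complex.ofReal_sin, Real.cos_neg,
      Real.sin_neg]
    simp only [planeWave, add_zero, Real.cos_add_pi_div_two]
    push_cast
    ring
  rw [h, ← Complex.normSq_eq_norm_sq, Complex.normSq_add_mul_I]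

/-- A plane wave is not an admissible test function, but its product with a bump equal to one on the
ball containing the supports is, and the integrals do not change. -/
theorem IsWeakDeriv.waveInt_eq {d : ℕ} {α : Fin d → ℕ} {f g : (Fin d → ℝ) → ℝ}
    (h : IsWeakDeriv univ α f g) {ρ : ℝ} (hρ : 0 < ρ) (hf : ∀ x, f x ≠ 0 → ‖x‖ < ρ)
    (hg : ∀ x, g x ≠ 0 → ‖x‖ < ρ) (a : Fin d → ℝ) (θ : ℝ) :
    (∏ i, a i ^ α i) * waveInt a f (θ + (∑ i, α i : ℕ) * (Real.pi / 2))
      = (-1 : ℝ) ^ (∑ i, α i) * waveInt a g θ := by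
  let χ : ContDiffBump (0 : Fin d → ℝ) := ⟨ρ, ρ + 1, hρ, by linarith⟩
  have hcs : HasCompactSupport fun x => χ x * planeWave a θ x := χ.hasCompactSupport.mul_right
  have key := h.2.2 (fun x => χ x * planeWave a θ x)
    (χ.contDiff.mul (contDiff_planeWave a θ)) hcs (subset_univ _)
  have heq : EqOn (fun x => χ x * planeWave a θ x) (planeWave a θ) (Metric.ball 0 ρ) := by
    intro x hx
    simp only
    rw [χ.one_of_mem_closedBall (Metric.ball_subset_closedBall hx), one_mul]
  have hD := multiDeriv_congr_of_isOpen Metric.isOpen_ball heq α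
  rw [setIntegral_univ, setIntegral_univ] at key
  have e1 : ∀ x, f x * multiDeriv α (fun x => χ x * planeWave a θ x) x
      = (∏ i, a i ^ α i) * (f x * planeWave a (θ + (∑ i, α i : ℕ) * (Real.pi / 2)) x) := by
    intro x
    by_cases hx : f x = 0
    · simp [hx]
    · rw [hD (by simpa using hf x hx), multiDeriv_planeWave]
      ring
  have e2 : ∀ x, g x * (χ x * planeWave a θ x) = g x * planeWave a θ x := by
    intro x
    by_cases hx : g x = 0
    · simp [hx]
    · have := heq (x := x) (by simpa using hg x hx)
      simp only at this
      rw [this]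
  simp only [e1, e2, integral_const_mul] at key
  exact key

/-- The Fourier transform turns a weak derivative into a multiplication by a monomial. -/
theorem IsWeakDeriv.norm_sq_fourierInt {d : ℕ} {α : Fin d → ℕ} {f g : (Fin d → ℝ) → ℝ}
    (h : IsWeakDeriv univ α f g) {ρ : ℝ} (hρ : 0 < ρ) (hf : ∀ x, f x ≠ 0 → ‖x‖ < ρ)
    (hg : ∀ x, g x ≠ 0 → ‖x‖ < ρ) (hfi : Integrable f) (hgi : Integrable g) (ξ : Fin d → ℝ) :
    ‖fourierInt (fun x => (g x : ℂ)) ξ‖ ^ 2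
      = (∏ i, (2 * Real.pi * ξ i) ^ (2 * α i)) * ‖fourierInt (fun x => (f x : ℂ)) ξ‖ ^ 2 := by
  rw [norm_sq_fourierInt_ofReal hgi, norm_sq_fourierInt_ofReal hfi]
  set a : Fin d → ℝ := fun i => 2 * Real.pi * ξ i with ha
  set n := ∑ i, α i
  -- The phase shift depends on |α|; adding the squares at two quarter-period phases removes it.
  have h1 := congrArg (· ^ 2) (h.waveInt_eq hρ hf hg a 0)
  have h2 := congrArg (· ^ 2) (h.waveInt_eq hρ hf hg a (Real.pi / 2))
  have h3 : ((-1 : ℝ) ^ n) ^ 2 = 1 := by rw [← pow_mul, mul_comm, pow_mul]; norm_num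
  simp only [mul_pow, zero_add] at h1 h2
  rw [h3, one_mul] at h1 h2
  rw [← h1, ← h2, ← mul_add, waveInt_sq_add_sq hfi a, ← Finset.prod_pow]
  congr 1
  exact Finset.prod_congr rfl fun i _ => by rw [← pow_mul, mul_comm]

/-! ### The mixed Sobolev norm controls the weighted lattice sum. -/

theorem isOpen_openCube (d : ℕ) : IsOpen (openCube d) :=
  isOpen_set_pi finite_univ fun _ _ => isOpen_Ioo

theorem openCube_ae_eq_Icc (d : ℕ) : openCube d =ᵐ[volume] Icc (0 : Fin d → ℝ) 1 :=
  Measure.univ_pi_Ioo_ae_eq_Icc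

theorem norm_lt_two_of_mem_Icc {d : ℕ} {x : Fin d → ℝ} (hx : x ∈ Icc (0 : Fin d → ℝ) 1) :
    ‖x‖ < 2 := by
  refine lt_of_le_of_lt ((pi_norm_le_iff_of_nonneg zero_le_one).2 fun i => ?_) one_lt_two
  rw [Real.norm_eq_abs, abs_le]
  have h1 := hx.1 i
  have h2 := hx.2 i
  simp only [Pi.zero_apply, Pi.one_apply] at h1 h2
  constructor <;> linarith

/-- A function in `HmixZero` has weak derivatives in `L²` supported in the unit cube whose norms
are those that enter the norm of `H^{r,mix}([0,1]^d)`. -/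
theorem exists_weakDeriv_of_mem_HmixZero {d r : ℕ} {f : (Fin d → ℝ) → ℝ} (hf : f ∈ HmixZero d r)
    {α : Fin d → ℕ} (hα : ∀ i, α i ≤ r) :
    ∃ g, IsWeakDeriv univ α f g ∧ MemLp g 2 ∧ (∀ x, g x ≠ 0 → x ∈ Icc (0 : Fin d → ℝ) 1) ∧
      ∫ x, g x ^ 2 = ∫ x in openCube d, weakDeriv (openCube d) α f x ^ 2 := by
  obtain ⟨g₀, hg₀, hL⟩ := hf.2.2.2 α hα
  rw [Measure.restrict_univ] at hL
  have hz := hg₀.ae_eq_zero_compl isClosed_Icc hf.2.1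
  -- Cutting off makes the support condition hold everywhere, not only almost everywhere.
  set g := (Icc (0 : Fin d → ℝ) 1).indicator g₀ with hgdef
  have hgg : g =ᵐ[volume] g₀ := by
    filter_upwards [hz] with x hx
    by_cases h : x ∈ Icc (0 : Fin d → ℝ) 1
    · simp only [hgdef, indicator_of_mem h]
    · rw [hgdef, indicator_of_notMem h, hx h]
  have hgL : MemLp g 2 := hL.indicator measurableSet_Icc
  have hg : IsWeakDeriv univ α f g := by
    refine ⟨hg₀.1, (hgL.locallyIntegrable one_le_two).locallyIntegrableOn _,
      fun φ h1 h2 h3 => (hg₀.2.2 φ h1 h2 h3).trans ?_⟩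
    congr 1
    rw [setIntegral_univ, setIntegral_univ]
    refine integral_congr_ae ?_
    filter_upwards [hgg] with x hx
    rw [hx]
  refine ⟨g, hg, hgL, fun x hx => ?_, ?_⟩
  · by_contra h
    exact hx (indicator_of_notMem h _)
  -- `weakDeriv` is an arbitrary choice, identified with `g` on the open cube by uniqueness.
  · have hex : ∃ u, IsWeakDeriv (openCube d) α f u := ⟨g, hg.mono⟩
    have hw : IsWeakDeriv (openCube d) α f (weakDeriv (openCube d) α f) := by
      rw [weakDeriv, dif_pos hex]
      exact hex.choose_spec
    have hae := (hg.mono (Ω := openCube d)).ae_eq (isOpen_openCube d) hw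
    have h1 : ∫ x, g x ^ 2 = ∫ x in Icc (0 : Fin d → ℝ) 1, g x ^ 2 := by
      refine (setIntegral_eq_integral_of_forall_compl_eq_zero fun x hx => ?_).symm
      rw [hgdef, indicator_of_notMem hx]
      norm_num
    rw [h1, ← setIntegral_congr_set (openCube_ae_eq_Icc d)]
    refine integral_congr_ae ?_
    filter_upwards [hae] with x hx
    rw [hx]

/-- The weight `h_r(x) = ∏ⱼ ∑_{k ≤ r} (2 π xⱼ)^{2k}`. -/
noncomputable def mixWeight {d : ℕ} (r : ℕ) (x : Fin d → ℝ) : ℝ :=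
  ∏ i, ∑ k : Fin (r + 1), (2 * Real.pi * x i) ^ (2 * (k : ℕ))

theorem one_le_mixWeight {d : ℕ} (r : ℕ) (x : Fin d → ℝ) : 1 ≤ mixWeight r x := by
  refine Finset.one_le_prod fun i _ => ?_
  rw [Fin.sum_univ_succ]
  simp only [Fin.val_zero, mul_zero, pow_zero, le_add_iff_nonneg_right]
  exact Finset.sum_nonneg fun k _ => Even.pow_nonneg (even_two_mul _) (2 * Real.pi * x i)

/-- Expanding the product yields exactly the squared Fourier multipliers of the derivatives D^α in
the norm. -/
theorem mixWeight_eq_sum {d : ℕ} (r : ℕ) (x : Fin d → ℝ) :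
    mixWeight r x
      = ∑ α : Fin d → Fin (r + 1), ∏ i, (2 * Real.pi * x i) ^ (2 * (α i : ℕ)) := by
  rw [mixWeight, Finset.prod_univ_sum, Fintype.piFinset_univ]

theorem hmixNormCube_sq {d r : ℕ} (f : (Fin d → ℝ) → ℝ) : hmixNormCube d r f ^ 2
    = ∑ α : Fin d → Fin (r + 1),
        ∫ x in openCube d, weakDeriv (openCube d) (fun i => (α i : ℕ)) f x ^ 2 :=
  Real.sq_sqrt (Finset.sum_nonneg fun _ _ => by positivity)

/-- The weighted sum of the squares of the Fourier transform at the points of a lattice is bounded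
by the norm of `H^{r,mix}([0,1]^d)`. -/
theorem sum_mixWeight_mul_sq_le {d r : ℕ} {f : (Fin d → ℝ) → ℝ} (hf : f ∈ HmixZero d r)
    {S : Matrix (Fin d) (Fin d) ℝ} (hS : S.det ≠ 0) {R : ℝ} (hR0 : 0 ≤ R)
    (hR : ∀ x ∈ Icc (0 : Fin d → ℝ) 1, ‖S.transpose.mulVec x‖ ≤ R) :
    Summable (fun m : Fin d → ℤ => mixWeight r (S.mulVec (intVec m))
        * ‖fourierInt (fun x => (f x : ℂ)) (S.mulVec (intVec m))‖ ^ 2) ∧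
      ∑' m : Fin d → ℤ, mixWeight r (S.mulVec (intVec m))
        * ‖fourierInt (fun x => (f x : ℂ)) (S.mulVec (intVec m))‖ ^ 2
        ≤ (2 * R + 3) ^ d / |S.det| * hmixNormCube d r f ^ 2 := by
  choose g hg hgL hgs hgn using fun α : Fin d → Fin (r + 1) =>
    exists_weakDeriv_of_mem_HmixZero hf (α := fun i => (α i : ℕ)) fun i => Nat.lt_succ_iff.1 (α i).2
  have hfs : ∀ x, f x ≠ 0 → x ∈ Icc (0 : Fin d → ℝ) 1 := fun x hx =>
    hf.2.1 (subset_tsupport f hx)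
  have hfi : Integrable f :=
    hf.1.integrable_of_hasCompactSupport (isCompact_Icc.of_isClosed_subset (isClosed_tsupport f) hf.2.1)
  have hgi : ∀ α, Integrable (g α) := fun α => by
    rw [← integrableOn_iff_integrable_of_support_subset (s := Icc (0 : Fin d → ℝ) 1)
      fun x hx => hgs α x hx]
    exact ((hgL α).locallyIntegrable one_le_two).integrableOn_isCompact isCompact_Icc
  have hid := fun α m => (hg α).norm_sq_fourierInt two_pos
    (fun x hx => norm_lt_two_of_mem_Icc (hfs x hx))
    (fun x hx => norm_lt_two_of_mem_Icc (hgs α x hx)) hfi (hgi α) (S.mulVec (intVec m))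
  have hB := fun α => sum_sq_fourierInt_lattice_le hS (H := fun x => (g α x : ℂ)) (hgL α).ofReal hR0
    fun x hx => hR x (hgs α x (Complex.ofReal_ne_zero.1 hx))
  have hterm : ∀ m : Fin d → ℤ, mixWeight r (S.mulVec (intVec m))
        * ‖fourierInt (fun x => (f x : ℂ)) (S.mulVec (intVec m))‖ ^ 2
      = ∑ α, ‖fourierInt (fun x => (g α x : ℂ)) (S.mulVec (intVec m))‖ ^ 2 := by
    intro m
    rw [mixWeight_eq_sum, Finset.sum_mul]
    exact Finset.sum_congr rfl fun α _ => (hid α m).symm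
  simp only [hterm]
  refine ⟨summable_sum fun α _ => (hB α).1, ?_⟩
  rw [Summable.tsum_finsetSum fun α _ => (hB α).1, hmixNormCube_sq, Finset.mul_sum]
  refine Finset.sum_le_sum fun α _ => ?_
  rw [← hgn α]
  simpa using (hB α).2

/-! ### Dyadic counting of lattice points. -/

/-- The index of the dyadic interval that contains `|t|`. -/
noncomputable def dyadicIndex (t : ℝ) : ℕ := Nat.size ⌊|t|⌋₊

theorem abs_lt_two_pow_dyadicIndex (t : ℝ) : |t| < 2 ^ dyadicIndex t := by
  have := Nat.lt_size_self ⌊|t|⌋₊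
  rw [Nat.floor_lt (abs_nonneg t)] at this
  exact_mod_cast this

/-- Index 0 collects all |t| < 1, where no such bound holds; index k ≥ 1 means 2^{k-1} ≤ |t| < 2^k.
-/
theorem two_pow_dyadicIndex_le {t : ℝ} (ht : dyadicIndex t ≠ 0) : 2 ^ dyadicIndex t ≤ 2 * |t| := by
  obtain ⟨k, hk⟩ := Nat.exists_eq_succ_of_ne_zero ht
  have h1 : k < Nat.size ⌊|t|⌋₊ := by rw [dyadicIndex] at hk; omega
  rw [Nat.lt_size, Nat.le_floor_iff (abs_nonneg t)] at h1
  push_cast at h1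
  rw [hk, pow_succ]
  linarith

/-- One summand suffices: k = 0 if the index is zero, otherwise k = r, where 2π ≥ 2 absorbs the
dyadic loss. -/
theorem two_pow_le_sum_pow (r : ℕ) (t : ℝ) :
    (2 ^ dyadicIndex t) ^ (2 * r) ≤ ∑ k : Fin (r + 1), (2 * Real.pi * t) ^ (2 * (k : ℕ)) := by
  have h : ∀ k : Fin (r + 1), 0 ≤ (2 * Real.pi * t) ^ (2 * (k : ℕ)) := fun k =>
    Even.pow_nonneg (even_two_mul _) _
  by_cases ht : dyadicIndex t = 0
  · rw [ht, pow_zero, one_pow]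
    refine le_trans ?_ (Finset.single_le_sum (fun k _ => h k) (Finset.mem_univ 0))
    simp
  · refine le_trans ?_ (Finset.single_le_sum (fun k _ => h k) (Finset.mem_univ (Fin.last r)))
    rw [Fin.val_last, ← (even_two_mul r).pow_abs (2 * Real.pi * t)]
    refine pow_le_pow_left₀ (by positivity) ((two_pow_dyadicIndex_le ht).trans ?_) _
    rw [abs_mul, abs_of_pos Real.two_pi_pos]
    have := Real.pi_gt_three
    exact mul_le_mul_of_nonneg_right (by linarith) (abs_nonneg t)

/-- The sum of the dyadic indices of the coordinates. -/
noncomputable def dyadicLevel {d : ℕ} (x : Fin d → ℝ) : ℕ := ∑ i, dyadicIndex (x i)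

theorem two_pow_dyadicLevel_le_mixWeight {d : ℕ} (r : ℕ) (x : Fin d → ℝ) :
    (2 ^ dyadicLevel x) ^ (2 * r) ≤ mixWeight r x := by
  rw [dyadicLevel, ← Finset.prod_pow_eq_pow_sum, ← Finset.prod_pow]
  exact Finset.prod_le_prod (fun _ _ => by positivity) fun i _ => two_pow_le_sum_pow r (x i)

theorem abs_prod_le_two_pow_dyadicLevel {d : ℕ} (x : Fin d → ℝ) :
    |∏ i, x i| ≤ 2 ^ dyadicLevel x := by
  rw [dyadicLevel, ← Finset.prod_pow_eq_pow_sum, Finset.abs_prod]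
  exact Finset.prod_le_prod (fun _ _ => abs_nonneg _) fun i _ =>
    (abs_lt_two_pow_dyadicIndex (x i)).le

/-- The number of vectors in `ℕ^{e+1}` with the sum `k` is at most `(k+1)^e`. -/
theorem card_le_of_sum_eq {e k : ℕ} {T : Finset (Fin (e + 1) → ℕ)} (hT : ∀ β ∈ T, ∑ i, β i = k) :
    T.card ≤ (k + 1) ^ e := by
  have hc : (Fintype.piFinset fun _ : Fin e => Finset.range (k + 1)).card = (k + 1) ^ e := by
    simp
  rw [← hc]
  -- The fixed sum determines the first coordinate, so forgetting it is injective.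
  refine Finset.card_le_card_of_injOn (fun β i => β i.succ) (fun β hβ => ?_) fun β hβ γ hγ h => ?_
  · simp only [Finset.mem_coe, Fintype.mem_piFinset, Finset.mem_range, Nat.lt_succ_iff]
    intro i
    rw [← hT β hβ]
    exact Finset.single_le_sum (f := β) (fun _ _ => Nat.zero_le _) (Finset.mem_univ i.succ)
  · have h1 := hT β hβ
    rw [← hT γ hγ, Fin.sum_univ_succ, Fin.sum_univ_succ] at h1
    have h2 : ∀ i : Fin e, β i.succ = γ i.succ := fun i => congrFun h i
    simp only [h2, add_left_inj] at h1
    funext i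
    exact Fin.cases h1 h2 i

/-- The number of points of a given dyadic level, if there are few points in every box. -/
theorem card_level_le {ι : Type*} {e k n : ℕ} {z : ι → Fin (e + 1) → ℝ} {t : Finset ι} (hn : 0 < n)
    (hk : n ≤ 2 ^ k)
    (hbox : ∀ t' ⊆ t, ∀ L : Fin (e + 1) → ℝ, (∀ j, 0 ≤ L j) → (∀ m ∈ t', ∀ j, |z m j| ≤ L j) →
      (t'.card : ℝ) ≤ (∏ j, 2 * L j) / n + 1)
    (ht : ∀ m ∈ t, dyadicLevel (z m) = k) :
    (t.card : ℝ) ≤ (k + 1) ^ e * ((2 ^ (e + 1) + 1) * 2 ^ k / n) := by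
  classical
  set b : ι → Fin (e + 1) → ℕ := fun m j => dyadicIndex (z m j)
  have hn' : (0 : ℝ) < n := by exact_mod_cast hn
  have hfib : ∀ β ∈ t.image b, ((t.filter fun m => b m = β).card : ℝ)
      ≤ (2 ^ (e + 1) + 1) * 2 ^ k / n := by
    intro β hβ
    have hβk : ∑ j, β j = k := by
      obtain ⟨m, hm, rfl⟩ := Finset.mem_image.1 hβ
      exact ht m hm
    refine (hbox _ (Finset.filter_subset _ _) (fun j => 2 ^ β j) (fun j => by positivity)
      fun m hm j => ?_).trans ?_
    · rw [Finset.mem_filter] at hm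
      rw [← hm.2]
      exact (abs_lt_two_pow_dyadicIndex _).le
    · rw [Finset.prod_mul_distrib, Finset.prod_pow_eq_pow_sum, hβk, Finset.prod_const,
        Finset.card_univ, Fintype.card_fin, add_mul, add_div, one_mul]
      -- The additive 1 of the box count is absorbed into 2^k/n; this needs n ≤ 2^k.
      have : (n : ℝ) ≤ 2 ^ k := by exact_mod_cast hk
      linarith [(one_le_div hn').2 this]
  have hcard : ((t.image b).card : ℝ) ≤ (k + 1) ^ e := by
    exact_mod_cast card_le_of_sum_eq (T := t.image b) fun β hβ => by
      obtain ⟨m, hm, rfl⟩ := Finset.mem_image.1 hβ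
      exact ht m hm
  rw [Finset.card_eq_sum_card_image b t]
  push_cast
  refine (Finset.sum_le_card_nsmul _ _ _ hfib).trans ?_
  rw [nsmul_eq_mul]
  exact mul_le_mul_of_nonneg_right hcard (by positivity)

theorem summable_polyGeometric (e : ℕ) :
    Summable fun i : ℕ => ((i : ℝ) + 1) ^ e * ((2 : ℝ) ^ i)⁻¹ := by
  have h := summable_pow_mul_geometric_of_norm_lt_one (R := ℝ) e (r := 1 / 2) (by norm_num)
  have h2 := ((summable_nat_add_iff 1).2 h).mul_left 2
  refine h2.congr fun i => ?_
  push_cast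
  rw [one_div, inv_pow, pow_succ 2 i, mul_inv]
  ring

theorem clog_add_one_le_log {n : ℕ} (hn : 2 ≤ n) : (Nat.clog 2 n : ℝ) + 1 ≤ 5 * Real.log n := by
  have hpos : 0 < Nat.clog 2 n := Nat.clog_pos one_lt_two hn
  obtain ⟨k, hk⟩ := Nat.exists_eq_succ_of_ne_zero hpos.ne'
  have h1 : 2 ^ k < n := by
    have := Nat.pow_pred_clog_lt_self one_lt_two hn
    rwa [hk, Nat.pred_succ] at this
  have h1' : (2 : ℝ) ^ k ≤ n := by exact_mod_cast h1.le
  have h2 := Real.log_le_log (by positivity) h1'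
  rw [Real.log_pow] at h2
  have h3 : Real.log 2 ≤ Real.log n := Real.log_le_log two_pos (by exact_mod_cast hn)
  have h4 := Real.log_two_gt_d9
  rw [hk]
  push_cast
  -- (k+2) log 2 ≤ 3 log n and log 2 > 0.6 give the constant 5 = 3/0.6.
  have h5 : ((k : ℝ) + 2) * 0.6 ≤ (k + 2) * Real.log 2 :=
    mul_le_mul_of_nonneg_left (by linarith) (by positivity)
  linarith

/-- With K = ⌈log₂ n⌉ one has K+i+1 ≤ (K+1)(i+1) and 2^K ≥ n, which separates the dependence on n
from a convergent series in i. Smoothness r = q+1 ≥ 1 makes the exponent 2r-1 at least 1, hence the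
decay 2^{-i}. -/
theorem level_term_le {e q n i : ℕ} (hn : 2 ≤ n) :
    ((Nat.clog 2 n + i : ℕ) + 1 : ℝ) ^ e * ((2 ^ (e + 1) + 1) * 2 ^ (Nat.clog 2 n + i) / n)
        * ((2 ^ (Nat.clog 2 n + i)) ^ (2 * (q + 1)))⁻¹
      ≤ (2 ^ (e + 1) + 1) * 5 ^ e * Real.log n ^ e * ((n : ℝ) ^ (2 * (q + 1)))⁻¹
        * (((i : ℝ) + 1) ^ e * ((2 : ℝ) ^ i)⁻¹) := by
  have hn0 : (0 : ℝ) < n := by positivity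
  set K := Nat.clog 2 n
  have hK : (n : ℝ) ≤ 2 ^ K := by exact_mod_cast Nat.le_pow_clog one_lt_two n
  have h1 : ((K + i : ℕ) + 1 : ℝ) ^ e ≤ (5 * Real.log n) ^ e * ((i : ℝ) + 1) ^ e := by
    rw [← mul_pow]
    refine pow_le_pow_left₀ (by positivity) ?_ e
    refine le_trans ?_ (mul_le_mul_of_nonneg_right (clog_add_one_le_log hn) (by positivity))
    push_cast
    have : (0 : ℝ) ≤ K * i := by positivity
    linarith
  have h2 : (2 : ℝ) ^ (K + i) * (((2 : ℝ) ^ (K + i)) ^ (2 * (q + 1)))⁻¹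
      ≤ ((n : ℝ) ^ (2 * q + 1))⁻¹ * ((2 : ℝ) ^ i)⁻¹ := by
    have hx : (0 : ℝ) < 2 ^ (K + i) := by positivity
    have e1 : (2 : ℝ) ^ (K + i) * (((2 : ℝ) ^ (K + i)) ^ (2 * (q + 1)))⁻¹
        = (((2 : ℝ) ^ (K + i)) ^ (2 * q + 1))⁻¹ := by
      rw [show 2 * (q + 1) = (2 * q + 1) + 1 by ring, pow_succ _ (2 * q + 1), mul_inv]
      field_simp
    rw [e1, ← mul_inv]
    refine inv_anti₀ (by positivity) ?_
    rw [pow_add (2 : ℝ) K i, mul_pow]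
    refine mul_le_mul (pow_le_pow_left₀ hn0.le hK _) ?_ (by positivity) (by positivity)
    exact le_self_pow₀ (one_le_pow₀ one_le_two) (by omega)
  calc _ = (2 ^ (e + 1) + 1) * (n : ℝ)⁻¹ * (((K + i : ℕ) + 1 : ℝ) ^ e
          * ((2 : ℝ) ^ (K + i) * (((2 : ℝ) ^ (K + i)) ^ (2 * (q + 1)))⁻¹)) := by
        rw [div_eq_mul_inv]; ring
    _ ≤ (2 ^ (e + 1) + 1) * (n : ℝ)⁻¹ * (((5 * Real.log n) ^ e * ((i : ℝ) + 1) ^ e)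
          * (((n : ℝ) ^ (2 * q + 1))⁻¹ * ((2 : ℝ) ^ i)⁻¹)) := by
        refine mul_le_mul_of_nonneg_left (mul_le_mul h1 h2 (by positivity) ?_) (by positivity)
        exact (by positivity : (0 : ℝ) ≤ ((K + i : ℕ) + 1 : ℝ) ^ e).trans h1
    _ = _ := by
        rw [show 2 * (q + 1) = (2 * q + 1) + 1 by ring, pow_succ (n : ℝ) (2 * q + 1), mul_inv,
          mul_pow]
        ring

/-- The sum of the reciprocal weights over a set of points that avoids the hyperbolic cross
`|∏ xⱼ| < n` and has few points in every box. -/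
theorem sum_inv_mixWeight_le {ι : Type*} {e q n : ℕ} (hn : 2 ≤ n) {z : ι → Fin (e + 1) → ℝ}
    {s : Finset ι} (hprod : ∀ m ∈ s, (n : ℝ) ≤ |∏ j, z m j|)
    (hbox : ∀ t ⊆ s, ∀ L : Fin (e + 1) → ℝ, (∀ j, 0 ≤ L j) → (∀ m ∈ t, ∀ j, |z m j| ≤ L j) →
      (t.card : ℝ) ≤ (∏ j, 2 * L j) / n + 1) :
    ∑ m ∈ s, (mixWeight (q + 1) (z m))⁻¹
      ≤ (2 ^ (e + 1) + 1) * 5 ^ e * Real.log n ^ e * ((n : ℝ) ^ (2 * (q + 1)))⁻¹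
        * ∑' i : ℕ, ((i : ℝ) + 1) ^ e * ((2 : ℝ) ^ i)⁻¹ := by
  classical
  set D := (2 ^ (e + 1) + 1) * 5 ^ e * Real.log n ^ e * ((n : ℝ) ^ (2 * (q + 1)))⁻¹ with hD
  set H : ℕ → ℝ := fun i => ((i : ℝ) + 1) ^ e * ((2 : ℝ) ^ i)⁻¹
  have hlog : 0 ≤ Real.log n := Real.log_natCast_nonneg n
  have hD0 : 0 ≤ D := by positivity
  set l : ι → ℕ := fun m => dyadicLevel (z m) with hl
  have hlevel : ∀ m ∈ s, n ≤ 2 ^ l m := fun m hm => by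
    exact_mod_cast (hprod m hm).trans (abs_prod_le_two_pow_dyadicLevel (z m))
  have hclog : ∀ k ∈ s.image l, Nat.clog 2 n ≤ k := fun k hk => by
    obtain ⟨m, hm, rfl⟩ := Finset.mem_image.1 hk
    exact Nat.clog_le_of_le_pow (hlevel m hm)
  have hstep : ∀ k ∈ s.image l,
      ∑ m ∈ s with l m = k, (mixWeight (q + 1) (z m))⁻¹ ≤ D * H (k - Nat.clog 2 n) := by
    intro k hk
    have hnk : n ≤ 2 ^ k := by
      obtain ⟨m, hm, rfl⟩ := Finset.mem_image.1 hk
      exact hlevel m hm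
    have hterm : ∀ m ∈ s.filter fun m => l m = k,
        (mixWeight (q + 1) (z m))⁻¹ ≤ (((2 : ℝ) ^ k) ^ (2 * (q + 1)))⁻¹ := fun m hm => by
      rw [← (Finset.mem_filter.1 hm).2]
      exact inv_anti₀ (by positivity) (two_pow_dyadicLevel_le_mixWeight (q + 1) (z m))
    have hcard := card_level_le (t := s.filter fun m => l m = k) (z := z) (by omega) hnk
      (fun t' ht' => hbox t' (ht'.trans (Finset.filter_subset _ _)))
      fun m hm => (Finset.mem_filter.1 hm).2
    obtain ⟨i, rfl⟩ := Nat.exists_eq_add_of_le (hclog k hk)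
    rw [Nat.add_sub_cancel_left]
    refine ((Finset.sum_le_card_nsmul _ _ _ hterm).trans ?_).trans (level_term_le hn)
    rw [nsmul_eq_mul]
    exact mul_le_mul_of_nonneg_right hcard (by positivity)
  rw [← Finset.sum_fiberwise_of_maps_to (t := s.image l) fun m hm => Finset.mem_image_of_mem l hm]
  refine (Finset.sum_le_sum hstep).trans ?_
  rw [← Finset.mul_sum]
  refine mul_le_mul_of_nonneg_left ?_ hD0
  -- Levels are at least `Nat.clog 2 n`, so the truncated subtraction is injective on them.
  rw [← Finset.sum_image (f := H) (g := fun k => k - Nat.clog 2 n)]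
  · exact (summable_polyGeometric e).sum_le_tsum _ fun i _ => by positivity
  · intro a ha b hb hab
    have h1 := hclog a ha
    have h2 := hclog b hb
    simp only at hab
    omega

/-! ### The dilated Frolov lattice, uniformly in n and u. -/

section Dilated

variable {e n : ℕ} {u : Fin (e + 1) → ℝ} {B : Matrix (Fin (e + 1)) (Fin (e + 1)) ℝ}

theorem rpow_inv_pow : ((n : ℝ) ^ ((1 : ℝ) / (e + 1 : ℕ))) ^ (e + 1) = n := by
  rw [one_div, Real.rpow_inv_natCast_pow (Nat.cast_nonneg n) (Nat.succ_ne_zero e)]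

theorem dilatedMatrix_mulVec (m : Fin (e + 1) → ℤ) (j : Fin (e + 1)) :
    (dilatedMatrix n u B).mulVec (intVec m) j
      = (n : ℝ) ^ ((1 : ℝ) / (e + 1 : ℕ)) * u j * latticePoint B m j := by
  rw [dilatedMatrix, Matrix.smul_mulVec, ← Matrix.mulVec_mulVec, Pi.smul_apply,
    Matrix.mulVec_diagonal, smul_eq_mul, mul_assoc]
  rfl

theorem det_dilatedMatrix :
    (dilatedMatrix n u B).det = n * (∏ j, u j) * B.det := by
  rw [dilatedMatrix, Matrix.det_smul, Matrix.det_mul, Matrix.det_diagonal, Fintype.card_fin,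
    rpow_inv_pow, mul_assoc]

theorem one_le_of_mem_dilationBox (hu : u ∈ dilationBox (e + 1)) (j : Fin (e + 1)) : 1 ≤ u j :=
  hu.1 j

theorem le_two_of_mem_dilationBox (hu : u ∈ dilationBox (e + 1)) (j : Fin (e + 1)) : u j ≤ 2 := by
  refine (hu.2 j).trans ?_
  simp only
  have h := Real.rpow_le_rpow_of_exponent_le (x := 2) one_le_two
    (y := (1 : ℝ) / (e + 1 : ℕ)) (z := 1) ?_
  · rwa [Real.rpow_one] at h
  · rw [div_le_one (by positivity)]
    push_cast
    linarith [(Nat.cast_nonneg e : (0 : ℝ) ≤ e)]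

theorem one_le_prod_of_mem_dilationBox (hu : u ∈ dilationBox (e + 1)) : 1 ≤ ∏ j, u j :=
  Finset.one_le_prod fun j _ => one_le_of_mem_dilationBox hu j

/-- The d factors n^{1/d} multiply to n, while ∏ u_j ≥ 1 and property (b) only help. -/
theorem le_abs_prod_dilatedMatrix_mulVec (hB : IsFrolovMatrix B) (hn : 2 ≤ n)
    (hu : u ∈ dilationBox (e + 1)) {m : Fin (e + 1) → ℤ} (hm : m ≠ 0) :
    (n : ℝ) ≤ |∏ j, (dilatedMatrix n u B).mulVec (intVec m) j| := by
  have h1 := one_le_prod_of_mem_dilationBox hu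
  have h2 := hB.one_le_abs_prod m hm
  simp only [dilatedMatrix_mulVec, Finset.prod_mul_distrib, Finset.prod_const, Finset.card_univ,
    Fintype.card_fin, rpow_inv_pow]
  rw [abs_mul, abs_of_nonneg (by positivity)]
  have hn0 : (0 : ℝ) ≤ n := Nat.cast_nonneg n
  calc (n : ℝ) = n * 1 * 1 := by ring
    _ ≤ _ := by gcongr

theorem latticePoint_injective (hB : IsFrolovMatrix B) : Function.Injective (latticePoint B) := by
  intro m k h
  have := Matrix.mulVec_injective_of_isUnit hB.isUnit h
  funext i
  exact_mod_cast congrFun this i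

/-- Undoing the dilation divides the volume of the box by n ∏ u_j ≥ n; then property (c) applies. -/
theorem card_le_of_dilatedMatrix_mulVec_le (hB : IsFrolovMatrix B) (hn : 2 ≤ n)
    (hu : u ∈ dilationBox (e + 1)) {t : Finset (Fin (e + 1) → ℤ)} {L : Fin (e + 1) → ℝ}
    (hL : ∀ j, 0 ≤ L j)
    (ht : ∀ m ∈ t, ∀ j, |(dilatedMatrix n u B).mulVec (intVec m) j| ≤ L j) :
    (t.card : ℝ) ≤ (∏ j, 2 * L j) / n + 1 := by
  have hn0 : (0 : ℝ) < n := by positivity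
  set D : ℝ := (n : ℝ) ^ ((1 : ℝ) / (e + 1 : ℕ))
  have hD : 0 < D := Real.rpow_pos_of_pos hn0 _
  have hu0 : ∀ j, 0 < u j := fun j => one_pos.trans_le (one_le_of_mem_dilationBox hu j)
  set y : Fin (e + 1) → ℝ := fun j => L j / (D * u j)
  have hy : ∀ j, 0 ≤ y j := fun j => div_nonneg (hL j) (mul_pos hD (hu0 j)).le
  obtain ⟨hfin, hcard⟩ := hB.card_box_le (-y) y
  set A := {z | z ∈ range (latticePoint B) ∧ ∀ j, z j ∈ uIcc ((-y) j) (y j)}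
  have hsub : latticePoint B '' t ⊆ A := by
    rintro _ ⟨m, hm, rfl⟩
    refine ⟨⟨m, rfl⟩, fun j => ?_⟩
    have h1 := ht m hm j
    rw [dilatedMatrix_mulVec, abs_mul, abs_of_pos (mul_pos hD (hu0 j)), ← le_div_iff₀'
      (mul_pos hD (hu0 j)), abs_le] at h1
    rw [Pi.neg_apply, uIcc_of_le (by linarith [hy j])]
    exact h1
  have h1 := ncard_le_ncard hsub hfin
  rw [ncard_image_of_injective _ (latticePoint_injective hB), ncard_coe_finset] at h1
  refine (Nat.cast_le.2 h1).trans (hcard.trans (add_le_add_left ?_ 1))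
  have h2 : ∏ j, |(-y) j - y j| = (∏ j, 2 * L j) / (n * ∏ j, u j) := by
    rw [show (n : ℝ) * ∏ j, u j = ∏ j, D * u j by
      rw [Finset.prod_mul_distrib, Finset.prod_const, Finset.card_univ, Fintype.card_fin,
        rpow_inv_pow], ← Finset.prod_div_distrib]
    refine Finset.prod_congr rfl fun j _ => ?_
    rw [Pi.neg_apply, abs_of_nonpos (by linarith [hy j])]
    simp only [y]
    ring
  rw [h2]
  refine div_le_div_of_nonneg_left (Finset.prod_nonneg fun j _ => by linarith [hL j]) hn0 ?_
  exact le_mul_of_one_le_right hn0.le (one_le_prod_of_mem_dilationBox hu)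

theorem norm_dilatedMatrix_transpose_mulVec_le (hu : u ∈ dilationBox (e + 1))
    {x : Fin (e + 1) → ℝ} (hx : x ∈ Icc (0 : Fin (e + 1) → ℝ) 1) :
    ‖(dilatedMatrix n u B).transpose.mulVec x‖
      ≤ (n : ℝ) ^ ((1 : ℝ) / (e + 1 : ℕ)) * (2 * ∑ i, ∑ j, |B i j|) := by
  set D : ℝ := (n : ℝ) ^ ((1 : ℝ) / (e + 1 : ℕ))
  have hD : 0 ≤ D := Real.rpow_nonneg (Nat.cast_nonneg n) _
  refine (pi_norm_le_iff_of_nonneg (by positivity)).2 fun j => ?_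
  have h1 : (dilatedMatrix n u B).transpose.mulVec x j = ∑ i, D * (u i * B i j) * x i := by
    simp [Matrix.mulVec, dotProduct, dilatedMatrix, Matrix.diagonal_mul, D]
  rw [h1, Real.norm_eq_abs]
  refine (Finset.abs_sum_le_sum_abs _ _).trans ?_
  rw [Finset.mul_sum, Finset.mul_sum]
  refine Finset.sum_le_sum fun i _ => ?_
  have hu1 := one_le_of_mem_dilationBox hu i
  have hu2 := le_two_of_mem_dilationBox hu i
  have hx1 : 0 ≤ x i := hx.1 i
  have hx2 : x i ≤ 1 := hx.2 i
  have hB : |B i j| ≤ ∑ j, |B i j| :=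
    Finset.single_le_sum (f := fun j => |B i j|) (fun _ _ => abs_nonneg _) (Finset.mem_univ j)
  rw [abs_mul, abs_mul, abs_mul, abs_of_nonneg hD, abs_of_nonneg hx1,
    abs_of_nonneg (zero_le_one.trans hu1)]
  calc D * (u i * |B i j|) * x i ≤ D * (2 * ∑ j, |B i j|) * 1 := by gcongr
    _ = _ := mul_one _

/-- Both numerator and determinant scale like n; n^{1/d} ≥ 1 lets the summand 3 be scaled along. -/
theorem covering_const_le (hB : IsFrolovMatrix B) (hn : 2 ≤ n) (hu : u ∈ dilationBox (e + 1)) {b : ℝ}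
    (hb : 0 ≤ b) : (2 * ((n : ℝ) ^ ((1 : ℝ) / (e + 1 : ℕ)) * b) + 3) ^ (e + 1)
      / |(dilatedMatrix n u B).det| ≤ (2 * b + 3) ^ (e + 1) / |B.det| := by
  have hn0 : (0 : ℝ) < n := by positivity
  set D : ℝ := (n : ℝ) ^ ((1 : ℝ) / (e + 1 : ℕ)) with hD
  have hD1 : 1 ≤ D := Real.one_le_rpow (by exact_mod_cast (by omega : 1 ≤ n)) (by positivity)
  have hdet : 0 < |B.det| := abs_pos.2 ((Matrix.isUnit_iff_isUnit_det B).1 hB.isUnit).ne_zero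
  have hu1 := one_le_prod_of_mem_dilationBox hu
  rw [det_dilatedMatrix, abs_mul, abs_of_nonneg (by positivity)]
  calc (2 * (D * b) + 3) ^ (e + 1) / (n * (∏ j, u j) * |B.det|)
      ≤ (D * (2 * b + 3)) ^ (e + 1) / (n * 1 * |B.det|) := by
        gcongr
        linarith
    _ = (2 * b + 3) ^ (e + 1) / |B.det| := by
        rw [mul_pow, hD, rpow_inv_pow]
        field_simp

end Dilated

/-! ### Cauchy–Schwarz and the final estimate. -/

/-- A weighted `ℓ²` bound and a bound of the sum of the reciprocal weights imply an `ℓ¹` bound. -/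
theorem summable_and_tsum_le_of_weighted {ι : Type*} {a w : ι → ℝ} {X Y : ℝ} (ha : ∀ i, 0 ≤ a i)
    (hw : ∀ i, 0 < w i) {p : ι → Prop} [DecidablePred p]
    (hX : ∀ s : Finset ι, (∀ i ∈ s, ¬ p i) → ∑ i ∈ s, (w i)⁻¹ ≤ X)
    (hs : Summable fun i => w i * a i ^ 2) (hY : ∑' i, w i * a i ^ 2 ≤ Y) :
    Summable (fun i => if p i then 0 else a i) ∧
      ∑' i, (if p i then 0 else a i) ≤ Real.sqrt (X * Y) := by
  have h0 : ∀ i, 0 ≤ if p i then 0 else a i := fun i => by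
    split_ifs
    exacts [le_rfl, ha i]
  have hX0 : 0 ≤ X := by simpa using hX ∅ (by simp)
  have key : ∀ s : Finset ι, ∑ i ∈ s, (if p i then 0 else a i) ≤ Real.sqrt (X * Y) := by
    intro s
    have h1 : ∑ i ∈ s, (if p i then 0 else a i) = ∑ i ∈ s with ¬ p i, a i := by
      rw [Finset.sum_filter]
      exact Finset.sum_congr rfl fun i _ => by split_ifs <;> simp_all
    rw [h1]
    refine Real.le_sqrt_of_sq_le ?_
    -- Cauchy–Schwarz for a = w^{-1/2} · w^{1/2} a. Bounding finite sums also yields the summability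
    -- that Poisson summation requires.
    have h2 := Finset.sum_mul_sq_le_sq_mul_sq (s.filter fun i => ¬ p i)
      (fun i => Real.sqrt (w i)⁻¹) fun i => Real.sqrt (w i) * a i
    have h3 : ∀ i, Real.sqrt (w i)⁻¹ * (Real.sqrt (w i) * a i) = a i := fun i => by
      rw [← mul_assoc, ← Real.sqrt_mul (inv_nonneg.2 (hw i).le), inv_mul_cancel₀ (hw i).ne',
        Real.sqrt_one, one_mul]
    simp only [h3, mul_pow, Real.sq_sqrt (hw _).le, Real.sq_sqrt (inv_nonneg.2 (hw _).le)] at h2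
    refine h2.trans (mul_le_mul (hX _ fun i hi => (Finset.mem_filter.1 hi).2) ?_ ?_ hX0)
    · exact (hs.sum_le_tsum _ fun i _ => mul_nonneg (hw i).le (sq_nonneg _)).trans hY
    · exact Finset.sum_nonneg fun i _ => mul_nonneg (hw i).le (sq_nonneg _)
  exact ⟨summable_of_sum_le h0 key, Real.tsum_le_of_sum_le h0 key⟩

/-- The error bound for Frolov's algorithm with dilation and shift. -/
theorem exists_abs_quadRule_sub_le (e q : ℕ) {B : Matrix (Fin (e + 1)) (Fin (e + 1)) ℝ}
    (hB : IsFrolovMatrix B) :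
    ∃ c : ℝ, 0 < c ∧ ∀ (v : Fin (e + 1) → ℝ) (n : ℕ), 2 ≤ n → ∀ f ∈ HmixZero (e + 1) (q + 1),
      ∀ u ∈ dilationBox (e + 1), |quadRule (dilatedMatrix n u B) v f - integralD f|
        ≤ c * (n : ℝ) ^ (-((q + 1 : ℕ) : ℝ)) * Real.log n ^ ((((e + 1 : ℕ) : ℝ) - 1) / 2)
          * hmixNormCube (e + 1) (q + 1) f := by
  set b : ℝ := 2 * ∑ i, ∑ j, |B i j|
  have hb : 0 ≤ b := by positivity
  set M : ℝ := (2 ^ (e + 1) + 1) * 5 ^ e * ∑' i : ℕ, ((i : ℝ) + 1) ^ e * ((2 : ℝ) ^ i)⁻¹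
  have hM : 0 ≤ M := mul_nonneg (by positivity) (tsum_nonneg fun i => by positivity)
  set P : ℝ := (2 * b + 3) ^ (e + 1) / |B.det|
  have hP : 0 ≤ P := by positivity
  -- The added 1 only ensures that the constant is positive.
  refine ⟨Real.sqrt (M * P) + 1, by positivity, fun v n hn f hf u hu => ?_⟩
  set S := dilatedMatrix n u B
  have hn0 : (0 : ℝ) < n := by positivity
  have hlog : 0 ≤ Real.log n := Real.log_natCast_nonneg n
  have hSdet : S.det ≠ 0 := by
    rw [det_dilatedMatrix]
    have := one_le_prod_of_mem_dilationBox hu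
    exact mul_ne_zero (by positivity) ((Matrix.isUnit_iff_isUnit_det B).1 hB.isUnit).ne_zero
  have hRx := fun x (hx : x ∈ Icc (0 : Fin (e + 1) → ℝ) 1) =>
    norm_dilatedMatrix_transpose_mulVec_le (n := n) (B := B) hu hx
  obtain ⟨hs, hY⟩ := sum_mixWeight_mul_sq_le hf hSdet (by positivity) hRx
  have hnorm : 0 ≤ hmixNormCube (e + 1) (q + 1) f := Real.sqrt_nonneg _
  set N := hmixNormCube (e + 1) (q + 1) f
  have hY' := hY.trans (mul_le_mul_of_nonneg_right (covering_const_le hB hn hu hb) (sq_nonneg N))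
  obtain ⟨h1, h2⟩ := summable_and_tsum_le_of_weighted (p := fun m : Fin (e + 1) → ℤ => m = 0)
    (fun m => norm_nonneg (fourierInt (fun x => (f x : ℂ)) (S.mulVec (intVec m))))
    (fun m => one_pos.trans_le (one_le_mixWeight (q + 1) (S.mulVec (intVec m))))
    (fun s hs => sum_inv_mixWeight_le hn
      (fun m hm => le_abs_prod_dilatedMatrix_mulVec hB hn hu (hs m hm))
      fun t _ L hL ht => card_le_of_dilatedMatrix_mulVec_le hB hn hu hL ht) hs hY'
  -- Restores the term m = 0, which does not affect summability.
  have h3 : Summable fun m : Fin (e + 1) → ℤ =>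
      ‖fourierInt (fun x => (f x : ℂ)) (S.mulVec (intVec m))‖ := by
    refine (h1.update 0 ‖fourierInt (fun x => (f x : ℂ)) (S.mulVec (intVec 0))‖).congr fun m => ?_
    rw [Function.update_apply]
    split_ifs with h
    · rw [h]
    · rfl
  refine (abs_quadRule_sub_integralD_le hSdet hf.1
    (fun x hx => hRx x (hf.2.1 (subset_tsupport f hx))) h3 v).trans (h2.trans ?_)
  set ℓ : ℝ := Real.log n ^ ((((e + 1 : ℕ) : ℝ) - 1) / 2)
  have hℓ0 : 0 ≤ ℓ := Real.rpow_nonneg hlog _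
  have hℓ : ℓ ^ 2 = Real.log n ^ e := by
    rw [← Real.rpow_natCast, ← Real.rpow_mul hlog, ← Real.rpow_natCast (Real.log n) e]
    congr 1
    push_cast
    ring
  have hpow : (n : ℝ) ^ (-((q + 1 : ℕ) : ℝ)) = ((n : ℝ) ^ (q + 1))⁻¹ := by
    rw [Real.rpow_neg hn0.le, Real.rpow_natCast]
  have hfactor : (2 ^ (e + 1) + 1) * 5 ^ e * Real.log n ^ e * ((n : ℝ) ^ (2 * (q + 1)))⁻¹
      * (∑' i : ℕ, ((i : ℝ) + 1) ^ e * ((2 : ℝ) ^ i)⁻¹) * (P * N ^ 2)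
      = M * P * (((n : ℝ) ^ (q + 1))⁻¹ * ℓ * N) ^ 2 := by
    rw [mul_pow, mul_pow, hℓ, inv_pow, ← pow_mul, mul_comm (q + 1) 2]
    ring
  have hnn : 0 ≤ ((n : ℝ) ^ (q + 1))⁻¹ * ℓ * N := by positivity
  rw [hfactor, Real.sqrt_mul (mul_nonneg hM hP), Real.sqrt_sq hnn, hpow]
  calc Real.sqrt (M * P) * (((n : ℝ) ^ (q + 1))⁻¹ * ℓ * N)
      ≤ (Real.sqrt (M * P) + 1) * (((n : ℝ) ^ (q + 1))⁻¹ * ℓ * N) :=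
        mul_le_mul_of_nonneg_right (le_add_of_nonneg_right zero_le_one) hnn
    _ = _ := by ring

end Frolov

theorem mainTheorem4 (d r : ℕ) (hd : 1 ≤ d) (hr : 1 ≤ r)
    (B : Matrix (Fin d) (Fin d) ℝ) (hB : Frolov.IsFrolovMatrix B) :
    ∃ c : ℝ, 0 < c ∧
      (∀ (v : Fin d → ℝ) (n : ℕ), 2 ≤ n → ∀ f ∈ Frolov.HmixZero d r,
        (⨆ u ∈ Frolov.dilationBox d, ENNReal.ofReal
            |Frolov.quadRule (Frolov.dilatedMatrix n u B) v f - Frolov.integralD f|)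
          ≤ ENNReal.ofReal (c * (n : ℝ) ^ (-(r : ℝ)) * Real.log n ^ (((d : ℝ) - 1) / 2)
              * Frolov.hmixNormCube d r f)) ∧
      (∀ n : ℕ, 2 ≤ n → ∀ f ∈ Frolov.HmixZero d r,
        |Frolov.quadRule ((n : ℝ) ^ ((1 : ℝ) / d) • B) 0 f - Frolov.integralD f|
          ≤ c * (n : ℝ) ^ (-(r : ℝ)) * Real.log n ^ (((d : ℝ) - 1) / 2)
              * Frolov.hmixNormCube d r f) := by
  obtain ⟨e, rfl⟩ := Nat.exists_eq_add_of_le' hd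
  obtain ⟨q, rfl⟩ := Nat.exists_eq_add_of_le' hr
  obtain ⟨c, hc, h⟩ := Frolov.exists_abs_quadRule_sub_le e q hB
  -- The supremum is taken in `ENNReal`, so the bound for each u suffices without a boundedness
  -- proof.
  refine ⟨c, hc, fun v n hn f hf => iSup₂_le fun u hu =>
    ENNReal.ofReal_le_ofReal (h v n hn f hf u hu), fun n hn f hf => ?_⟩
  have h1 : (1 : Fin (e + 1) → ℝ) ∈ Frolov.dilationBox (e + 1) :=
    ⟨le_rfl, fun _ => Real.one_le_rpow one_le_two (by positivity)⟩
  have h2 := h 0 n hn f hf 1 h1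
  rwa [Frolov.dilatedMatrix,
    show (Matrix.diagonal 1 : Matrix (Fin (e + 1)) (Fin (e + 1)) ℝ) = 1 from Matrix.diagonal_one,
     one_mul] at h2
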